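/- Let $n\ge 0$, let $A_1,A_2$ be $\mathbb R$-linearly independent Hermitian $n\times n$ matrices with $\ker A_1\cap\ker A_2=\{0\}$, and let $Q\subset\mathbb C^{n}\times\mathbb C^2$ be the (nondegenerate, codimension $2$) quadric $\{(z,w): \operatorname{Im} w_l={}^t\bar z A_l z,\ l=1,2\}$. Give each $z_j$ weight $\tfrac12$ and each $w_l$ weight $1$. For $\mu\in\mathbb Q$ let $G_\mu$ be the set of holomorphic vector fields $Y=\sum_j F_j\,\partial/\partial z_j+\sum_l H_l\,\partial/\partial w_l$ such that $F_j$ and $H_l$ are weighted homogeneous polynomials in $(z,w)$ (possibly zero) of degree $\mu+\tfrac12$ and $\mu+1$ respectively, and $\operatorname{Re}Y$ is tangent to $Q$ near $0$ (that is, $Y\in \mathrm{aut}(Q,0)$). Let $G_\mu^R\subset G_\mu$ be the subset of rigid fields, i.e. those whose coefficients depend only on $z$. Write $W_l=\partial/\partial w_l$ and $\mathcal D^{(k)}_l(Y)=[\dots[[Y,W_l],W_l],\dots,W_l]$ ($k$ brackets). For $X\in G_\mu^R$ and $k=(k_1,k_2)\in\mathbb Z_{\ge0}^2$ with $|k|=k_1+k_2$,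 a field $Y\in G_{\mu+|k|}$ is called a $|k|$-integration of $X$ if $\mathcal D^{(k_1)}_1(\mathcal D^{(k_2)}_2(Y))=X$, where $X=0$ is allowed only if $Y=0$. For $m\ge 0$ let $\mathcal D^{-m}(G_\mu^R)$ be the set of all $m$-integrations of elements of $G_\mu^R$ (over all $k$ with $|k|=m$). Then: 1. $\mathcal D^{-1}(G_0^R)\setminus\bigl(\mathcal D^{-1}(G_0^R)\cap\mathcal D^{-2}(G_{-1}^R)\bigr)\subseteq\{0\}$; that is, every nonzero $1$-integration of an element of $G_0^R$ is also a $2$-integration of an element of $G_{-1}^R$. 2. $\mathcal D^{-2}(G_{-1/2}^R)=\{0\}$. 3. $\mathcal D^{-1}(G_{-1}^R)$ contains a nonzero vector field, and $\mathcal D^{-3}(G_{-1}^R)=\{0\}$. -/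

import Mathlib

open scoped Topology Matrix

namespace QuadricAut

/-- The ambient space `ℂⁿ × ℂᵈ` with coordinates `(z, w)`. -/
abbrev Ambient (n d : ℕ) : Type := (Fin n → ℂ) × (Fin d → ℂ)

/-- Polynomials in the coordinates `(z, w)`: `Sum.inl j` is the variable `z_j` and
`Sum.inr l` is the variable `w_l`. -/
abbrev Poly (n d : ℕ) : Type := MvPolynomial (Fin n ⊕ Fin d) ℂ

/-- Holomorphic polynomial vector fields `∑ F_j ∂/∂z_j + ∑ G_l ∂/∂w_l` on `ℂⁿ × ℂᵈ`, as derivations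
of the polynomial ring. The coefficients are the values on the variables, and the Lie bracket is
Mathlib's commutator bracket `⁅Y, Z⁆ = Y ∘ Z - Z ∘ Y` of derivations. -/
abbrev PolyField (n d : ℕ) : Type := Derivation ℂ (Poly n d) (Poly n d)

variable {n d : ℕ}

/-- The Hermitian form `ᵗz̄ A z` (which is real when `A` is Hermitian). -/
noncomputable def hermForm (A : Matrix (Fin n) (Fin n) ℂ) (z : Fin n → ℂ) : ℝ :=
  (star z ⬝ᵥ (A *ᵥ z)).re

/-- The defining function `Im w_l - ᵗz̄ A_l z`. -/
noncomputable def defFun (A : Fin d → Matrix (Fin n) (Fin n) ℂ) (l : Fin d)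
    (p : Ambient n d) : ℝ :=
  (p.2 l).im - hermForm (A l) p.1

/-- The quadric `Im w_l = ᵗz̄ A_l z`, `l = 1, …, d`. -/
def quadric (A : Fin d → Matrix (Fin n) (Fin n) ℂ) : Set (Ambient n d) :=
  {p | ∀ l, defFun A l p = 0}

/-- The quadric is given by linearly independent Hermitian matrices whose kernels have trivial
intersection. -/
structure Nondegenerate (A : Fin d → Matrix (Fin n) (Fin n) ℂ) : Prop where
  isHermitian : ∀ l, (A l).IsHermitian
  linearIndependent : LinearIndependent ℝ A
  ker_inter : ∀ z : Fin n → ℂ, (∀ l, A l *ᵥ z = 0) → z = 0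

/-- `aut(Q, 0)`: vector fields holomorphic near `0` whose real part is tangent to the quadric near
`0`. (The real vector field `2 Re Z` has at `p` the value `Z p`, seen as a real tangent vector of
`ℂⁿ × ℂᵈ`.) -/
def aut (A : Fin d → Matrix (Fin n) (Fin n) ℂ) : Set (Ambient n d → Ambient n d) :=
  {Z | AnalyticAt ℂ Z 0 ∧
    ∀ᶠ p in 𝓝[quadric A] 0, ∀ l, fderiv ℝ (defFun A l) p (Z p) = 0}

/-- The map `ℂⁿ × ℂᵈ → ℂⁿ × ℂᵈ` given by the coefficients of a polynomial vector field. -/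
noncomputable def toMap (Y : PolyField n d) (p : Ambient n d) : Ambient n d :=
  (fun j => MvPolynomial.eval (Sum.elim p.1 p.2) (Y (MvPolynomial.X (Sum.inl j))),
   fun l => MvPolynomial.eval (Sum.elim p.1 p.2) (Y (MvPolynomial.X (Sum.inr l))))

/-- The variables `z_j` have weight `1/2`, the variables `w_l` have weight `1`. -/
def wt (n d : ℕ) : Fin n ⊕ Fin d → ℚ := Sum.elim (fun _ => 1 / 2) (fun _ => 1)

/-- A polynomial vector field is weighted homogeneous of weight `μ` if its `∂/∂z_j`-coefficients
are weighted homogeneous of degree `μ + 1/2` and its `∂/∂w_l`-coefficients of degree `μ + 1`. -/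
def HasWeight (μ : ℚ) (Y : PolyField n d) : Prop :=
  (∀ j, MvPolynomial.IsWeightedHomogeneous (wt n d) (Y (MvPolynomial.X (Sum.inl j))) (μ + 1 / 2)) ∧
  (∀ l, MvPolynomial.IsWeightedHomogeneous (wt n d) (Y (MvPolynomial.X (Sum.inr l))) (μ + 1))

/-- The graded piece `G_μ` of `aut(Q, 0)`. -/
def G (A : Fin d → Matrix (Fin n) (Fin n) ℂ) (μ : ℚ) : Set (PolyField n d) :=
  {Y | HasWeight μ Y ∧ toMap Y ∈ aut A}

/-- A vector field is rigid if its coefficients do not involve any of the variables `w_l`. -/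
def IsRigid (Y : PolyField n d) : Prop :=
  ∀ c l, Sum.inr l ∉ (Y (MvPolynomial.X c)).vars

/-- `G_μ^R`: the rigid vector fields in `G_μ`. -/
def GR (A : Fin d → Matrix (Fin n) (Fin n) ℂ) (μ : ℚ) : Set (PolyField n d) :=
  {Y | Y ∈ G A μ ∧ IsRigid Y}

/-- The vector field `W_l = ∂/∂w_l`. -/
noncomputable def W (l : Fin d) : PolyField n d := MvPolynomial.pderiv (Sum.inr l)

/-- The string of `k` brackets `[…[[Y, W_l], W_l], …, W_l]`. -/
noncomputable def bracketW (l : Fin d) (k : ℕ) (Y : PolyField n d) : PolyField n d :=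
  (fun Z => ⁅Z, W l⁆)^[k] Y

/-- `D^{(k_1)}(⋯ (D^{(k_d)}(Y)) ⋯)`. -/
noncomputable def multiBracket (k : Fin d → ℕ) (Y : PolyField n d) : PolyField n d :=
  (List.finRange d).foldr (fun l Z => bracketW l (k l) Z) Y

/-- `Y ∈ G_{μ+|k|}` is a `|k|`-integration, along the multi-index `k`, of `X ∈ G_μ^R`. The last
clause expresses that a nonzero field is not regarded as an integration of `0`. -/
def IsIntegration (A : Fin d → Matrix (Fin n) (Fin n) ℂ) (μ : ℚ) (k : Fin d → ℕ)
    (X Y : PolyField n d) : Prop :=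
  X ∈ GR A μ ∧ Y ∈ G A (μ + ((∑ l, k l : ℕ) : ℚ)) ∧ multiBracket k Y = X ∧ (X = 0 → Y = 0)

/-- `D^{-m}(G_μ^R)`: all `m`-integrations of elements of `G_μ^R`, along all multi-indices `k` with
`|k| = m`. -/
def integrations (A : Fin d → Matrix (Fin n) (Fin n) ℂ) (m : ℕ) (μ : ℚ) : Set (PolyField n d) :=
  {Y | ∃ (k : Fin d → ℕ) (X : PolyField n d), ∑ l, k l = m ∧ IsIntegration A μ k X Y}

end QuadricAut

/-! Write `F` and `H` for the `∂/∂z`- and `∂/∂w`-coefficients of a field, and a superscript for the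
degree in `z`. Weighted dilations spread tangency from a neighbourhood of `0` to all of the quadric.
The rotations `z ↦ t z`, `|t| = 1`, preserve the quadric and fix `w`, so tangency splits into
Fourier modes in `t` (`tangent_parts`): with `⟨z, v⟩ = ᵗz̄ A_l v`, `Im H⁰ = 2 Re ⟨z, F¹⟩` and `H¹ =
2i (⟨z, F²⟩ + conj ⟨z, F⁰⟩)`, at `w = u + i h(z)`, where `h(z)` lists the values of the Hermitian
forms and `u` is an arbitrary real vector.

Weights `2` and `3/2`: taking `u = s h(z)` gives `w = (s + i) h(z)`, and homogeneity turns the modes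
into identities in the real number `s`. A few values of `s` force `H⁰`, respectively `⟨z, F⁰⟩`, to
vanish at `w = h(z)`. Polarization replaces `h(z)` by the pairs `(ζ A_0 z, ζ A_1 z)`, which fill
`ℂ²` for generic `ζ`; hence `H⁰ = 0` (`wPart_eq_zero`), respectively `F⁰ = 0` (`zPart_eq_zero`).
Brackets with `W_l` differentiate the coefficients in `w` up to sign, so the integrated field `X`
vanishes.

Weight `1`: if all double brackets of `Y` vanish, then `H⁰ = 0`. With `F¹ = ∑ w_k B_k z`, tangency
makes every `A_l B_k` skew-Hermitian and gives `∑ h_k(z) ⟨z, B_k z⟩ = 0`. `matrices_eq_zero` deduces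
`B_k = 0`, so every rigid single bracket of `Y` vanishes. Thus if `X ≠ 0`, some double bracket is
nonzero; it is a real constant field, hence lies in `G_{-1}^R`. The Euler field supplies the nonzero
`1`-integration. -/

namespace QuadricAut

/-! ### Weighted homogeneous polynomials and restriction to `z = 0` -/

section

variable {n d : ℕ}

/-- The doubled weights: `1` for the variables `z_j` and `2` for the variables `w_l`. -/
def natWt (n d : ℕ) : Fin n ⊕ Fin d → ℕ := Sum.elim (fun _ => 1) (fun _ => 2)

/-- Evaluation of a polynomial at `(z, w)`. -/
noncomputable abbrev ev (z : Fin n → ℂ) (w : Fin d → ℂ) : Poly n d →+* ℂ :=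
  MvPolynomial.eval (Sum.elim z w)

lemma weight_wt (m : Fin n ⊕ Fin d →₀ ℕ) :
    Finsupp.weight (wt n d) m = (Finsupp.weight (natWt n d) m : ℚ) / 2 := by
  simp only [Finsupp.weight_apply, Finsupp.sum, smul_eq_mul, nsmul_eq_mul]
  push_cast
  rw [Finset.sum_div]
  refine Finset.sum_congr rfl fun i _ => ?_
  rcases i with i | i
  · simp [wt, natWt, div_eq_mul_inv]
  · simp [wt, natWt]

lemma isWeightedHomogeneous_natWt {f : Poly n d} {μ : ℚ} {N : ℕ}
    (hf : MvPolynomial.IsWeightedHomogeneous (wt n d) f μ) (h : μ = N / 2) :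
    MvPolynomial.IsWeightedHomogeneous (natWt n d) f N := by
  intro m hm
  have := hf hm
  rw [weight_wt, h] at this
  have h2 : (Finsupp.weight (natWt n d) m : ℚ) = N := by linarith
  exact_mod_cast h2

lemma eq_zero_of_weight_neg {f : Poly n d} {μ : ℚ}
    (hf : MvPolynomial.IsWeightedHomogeneous (wt n d) f μ) (h : μ < 0) : f = 0 := by
  ext m
  by_contra hm
  have := hf hm
  rw [weight_wt] at this
  have h2 : (0 : ℚ) ≤ (Finsupp.weight (natWt n d) m : ℚ) / 2 := by positivity
  linarith

lemma ev_smul {f : Poly n d} {N : ℕ}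
    (hf : MvPolynomial.IsWeightedHomogeneous (natWt n d) f N) (t : ℂ) (z : Fin n → ℂ)
    (w : Fin d → ℂ) : ev (t • z) (t ^ 2 • w) f = t ^ N * ev z w f := by
  simp only [ev, MvPolynomial.eval_eq, Finset.mul_sum]
  refine Finset.sum_congr rfl fun m hm => ?_
  have hN := hf (MvPolynomial.mem_support_iff.mp hm)
  rw [← hN, mul_left_comm]
  congr 1
  rw [Finsupp.weight_apply, Finsupp.sum, ← Finset.prod_pow_eq_pow_sum, ← Finset.prod_mul_distrib]
  refine Finset.prod_congr rfl fun i _ => ?_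
  have key : Sum.elim (t • z) (t ^ 2 • w) i = t ^ natWt n d i * Sum.elim z w i := by
    rcases i with i | i <;> simp [natWt]
  rw [key, mul_pow, ← pow_mul, smul_eq_mul, mul_comm (natWt n d i)]

lemma ev_eq_of_weight_zero {f : Poly n d}
    (hf : MvPolynomial.IsWeightedHomogeneous (natWt n d) f 0) (z : Fin n → ℂ)
    (w : Fin d → ℂ) : ev z w f = ev 0 0 f := by
  have := ev_smul hf 0 z w
  simpa using this.symm

/-- Euler's identity at a point with `z = 0`. -/
lemma euler_zero {f : Poly n d} {N : ℕ}
    (hf : MvPolynomial.IsWeightedHomogeneous (natWt n d) f N) (w : Fin d → ℂ) :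
    ∑ l, 2 * (w l * ev 0 w (MvPolynomial.pderiv (Sum.inr l) f)) = N * ev 0 w f := by
  have := congrArg (ev (0 : Fin n → ℂ) w) hf.sum_weight_X_mul_pderiv
  simpa [natWt, Fintype.sum_sum_type, nsmul_eq_mul] using this

lemma pderiv_inr_weight {f : Poly n d} {N : ℕ}
    (hf : MvPolynomial.IsWeightedHomogeneous (natWt n d) f (N + 2)) (l : Fin d) :
    MvPolynomial.IsWeightedHomogeneous (natWt n d) (MvPolynomial.pderiv (Sum.inr l) f) N :=
  MvPolynomial.IsWeightedHomogeneous.pderiv hf rfl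

lemma pderiv_inl_weight {f : Poly n d} {N : ℕ}
    (hf : MvPolynomial.IsWeightedHomogeneous (natWt n d) f (N + 1)) (j : Fin n) :
    MvPolynomial.IsWeightedHomogeneous (natWt n d) (MvPolynomial.pderiv (Sum.inl j) f) N :=
  MvPolynomial.IsWeightedHomogeneous.pderiv hf rfl

lemma pderiv_comm {σ : Type*} (i j : σ) (f : MvPolynomial σ ℂ) :
    MvPolynomial.pderiv i (MvPolynomial.pderiv j f)
      = MvPolynomial.pderiv j (MvPolynomial.pderiv i f) := by
  classical
  have h : ⁅MvPolynomial.pderiv (R := ℂ) i, MvPolynomial.pderiv (R := ℂ) j⁆ = 0 := by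
    refine MvPolynomial.derivation_ext fun k => ?_
    rw [Derivation.commutator_apply, MvPolynomial.pderiv_X, MvPolynomial.pderiv_X]
    simp [Pi.single_apply, apply_ite]
  have := DFunLike.congr_fun h f
  rw [Derivation.commutator_apply] at this
  simpa [sub_eq_zero] using this

/-- Restriction of a polynomial to `z = 0`. -/
noncomputable def zeroZ : Poly n d →ₐ[ℂ] MvPolynomial (Fin d) ℂ :=
  MvPolynomial.aeval (Sum.elim 0 MvPolynomial.X)

lemma eval_zeroZ (f : Poly n d) (w : Fin d → ℂ) :
    MvPolynomial.eval w (zeroZ f) = ev 0 w f := by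
  induction f using MvPolynomial.induction_on with
  | C a => simp [zeroZ]
  | add p q hp hq => simp [hp, hq]
  | mul_X p i hp =>
    rw [map_mul, map_mul, map_mul, hp]
    congr 1
    rcases i with i | i <;> simp [zeroZ]

lemma zeroZ_pderiv (f : Poly n d) (l : Fin d) :
    zeroZ (MvPolynomial.pderiv (Sum.inr l) f) = MvPolynomial.pderiv l (zeroZ f) := by
  classical
  induction f using MvPolynomial.induction_on with
  | C a => simp [zeroZ]
  | add p q hp hq => simp [hp, hq]
  | mul_X p i hp =>
    rw [MvPolynomial.pderiv_mul, map_add, map_mul, map_mul, map_mul, MvPolynomial.pderiv_mul, hp]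
    congr 2
    rcases i with i | i <;> simp [zeroZ, MvPolynomial.pderiv_X, Pi.single_apply, apply_ite]

lemma zeroZ_eq_zero {f : Poly n d} (h : ∀ w, ev 0 w f = 0) : zeroZ f = 0 :=
  MvPolynomial.funext fun w => by rw [eval_zeroZ, h, map_zero]

lemma ev_zero_pderiv {f : Poly n d} (h : ∀ w, ev 0 w f = 0) (l : Fin d) (w : Fin d → ℂ) :
    ev 0 w (MvPolynomial.pderiv (Sum.inr l) f) = 0 := by
  rw [← eval_zeroZ, zeroZ_pderiv, zeroZ_eq_zero h, map_zero, map_zero]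

/-- If `f(0, u)` is real for real `u`, so are its derivatives. -/
lemma real_pderiv {f : Poly n d} (h : ∀ u : Fin d → ℝ, (ev 0 (fun l => (u l : ℂ)) f).im = 0)
    (l : Fin d) (u : Fin d → ℝ) :
    (ev 0 (fun l => (u l : ℂ)) (MvPolynomial.pderiv (Sum.inr l) f)).im = 0 := by
  have hconj : ∀ (p : MvPolynomial (Fin d) ℂ) (u : Fin d → ℝ),
      MvPolynomial.eval (fun l => (u l : ℂ)) (MvPolynomial.map (starRingEnd ℂ) p)
        = starRingEnd ℂ (MvPolynomial.eval (fun l => (u l : ℂ)) p) := by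
    intro p u
    rw [MvPolynomial.eval_map, ← MvPolynomial.eval₂_id, MvPolynomial.hom_eval₂]
    congr 1
    ext l
    simp
  -- A polynomial that is real at all real points has real coefficients, a property that
  -- differentiation preserves.
  have h1 : MvPolynomial.map (starRingEnd ℂ) (zeroZ f) = zeroZ f := by
    refine MvPolynomial.funext_set (fun _ => Set.range ((↑) : ℝ → ℂ))
      (fun _ => Set.infinite_range_of_injective Complex.ofReal_injective) fun x hx => ?_
    choose u hu using fun i => hx i trivial
    obtain rfl : (fun l => (u l : ℂ)) = x := funext hu
    rw [hconj, eval_zeroZ]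
    exact Complex.conj_eq_iff_im.mpr (h u)
  rw [← eval_zeroZ, zeroZ_pderiv, ← Complex.conj_eq_iff_im, ← hconj, ← MvPolynomial.pderiv_map,
    h1]

end

/-! ### Expansion in powers of `z` and Fourier modes on the unit circle -/

section

variable {n d : ℕ}

open Polynomial in
/-- The polynomial `t ↦ f(t z, w)` in one variable. -/
noncomputable def slice (f : Poly n d) (z : Fin n → ℂ) (w : Fin d → ℂ) : ℂ[X] :=
  MvPolynomial.aeval (Sum.elim (fun j => C (z j) * X) (fun l => C (w l))) f

lemma slice_mul (p q : Poly n d) (z : Fin n → ℂ) (w : Fin d → ℂ) :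
    slice (p * q) z w = slice p z w * slice q z w := map_mul _ _ _

lemma slice_X_inl (j : Fin n) (z : Fin n → ℂ) (w : Fin d → ℂ) :
    slice (MvPolynomial.X (Sum.inl j)) z w = Polynomial.C (z j) * Polynomial.X := by
  simp only [slice, MvPolynomial.aeval_X, Sum.elim_inl]

lemma slice_X_inr (l : Fin d) (z : Fin n → ℂ) (w : Fin d → ℂ) :
    slice (MvPolynomial.X (Sum.inr l)) z w = Polynomial.C (w l) := by
  simp only [slice, MvPolynomial.aeval_X, Sum.elim_inr]

lemma eval_slice (f : Poly n d) (z : Fin n → ℂ) (w : Fin d → ℂ) (t : ℂ) :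
    (slice f z w).eval t = ev (t • z) w f := by
  induction f using MvPolynomial.induction_on with
  | C a => simp [slice]
  | add p q hp hq => simp_all [slice]
  | mul_X p i hp =>
    rw [slice_mul, Polynomial.eval_mul, hp, map_mul]
    congr 1
    rcases i with i | i
    · simp [slice_X_inl, mul_comm (z i)]
    · simp [slice_X_inr]

lemma slice_coeff_zero (f : Poly n d) (z : Fin n → ℂ) (w : Fin d → ℂ) :
    (slice f z w).coeff 0 = ev 0 w f := by
  rw [Polynomial.coeff_zero_eq_eval_zero, eval_slice, zero_smul]

lemma slice_coeff_one (f : Poly n d) (z : Fin n → ℂ) (w : Fin d → ℂ) :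
    (slice f z w).coeff 1 = ∑ j, z j * ev 0 w (MvPolynomial.pderiv (Sum.inl j) f) := by
  classical
  induction f using MvPolynomial.induction_on with
  | C a => simp [slice]
  | add p q hp hq =>
    simp only [slice, map_add, Polynomial.coeff_add] at hp hq ⊢
    rw [hp, hq, ← Finset.sum_add_distrib]
    simp only [mul_add]
  | mul_X p i hp =>
    have h0 := slice_coeff_zero p z w
    rw [slice_mul, Polynomial.mul_coeff_one, h0, hp]
    simp only [MvPolynomial.pderiv_mul, map_add, map_mul, MvPolynomial.pderiv_X, mul_add,
      Finset.sum_add_distrib, Finset.sum_mul]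
    rcases i with i | i
    · simp [slice_X_inl, Pi.single_apply, mul_comm (z i)]
    · simp [slice_X_inr, Polynomial.coeff_C, mul_assoc]

lemma slice_coeff_smul {f : Poly n d} {N : ℕ}
    (hf : MvPolynomial.IsWeightedHomogeneous (natWt n d) f N) (t : ℂ) (z : Fin n → ℂ)
    (w : Fin d → ℂ) (k : ℕ) :
    (slice f z (t ^ 2 • w)).coeff k * t ^ k = t ^ N * (slice f z w).coeff k := by
  have : (slice f z (t ^ 2 • w)).comp (Polynomial.C t * Polynomial.X)
      = Polynomial.C (t ^ N) * slice f z w := by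
    refine Polynomial.funext fun s => ?_
    rw [Polynomial.eval_comp, Polynomial.eval_mul (p := Polynomial.C (t ^ N)), Polynomial.eval_C,
      eval_slice, eval_slice, ← ev_smul hf]
    simp [smul_smul]
  have h2 := congrArg (fun p => p.coeff k) this
  simpa only [Polynomial.comp_C_mul_X_coeff, Polynomial.coeff_C_mul] using h2

lemma slice_coeff_smul' {f : Poly n d} {N m k : ℕ}
    (hf : MvPolynomial.IsWeightedHomogeneous (natWt n d) f N) (h : N = 2 * m + k) {c : ℂ}
    (hc : c ≠ 0) (z : Fin n → ℂ) (w : Fin d → ℂ) :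
    (slice f z (c • w)).coeff k = c ^ m * (slice f z w).coeff k := by
  -- Since `w` has doubled weight `2`, scaling `w` alone by `c` uses the dilation by a square root
  -- of `c`; the factor `t ^ k` coming from `z` is then cancelled.
  obtain ⟨t, rfl⟩ := IsAlgClosed.exists_pow_nat_eq c two_pos
  have ht : t ≠ 0 := by rintro rfl; simp at hc
  have := slice_coeff_smul hf t z w k
  rw [h, pow_add, pow_mul, mul_right_comm] at this
  exact mul_right_cancel₀ (pow_ne_zero k ht) this

/-- A polynomial whose real part vanishes on the unit circle is an imaginary constant. -/
lemma coeff_of_re_eq_zero (R : Polynomial ℂ) (h : ∀ t : ℂ, ‖t‖ = 1 → (R.eval t).re = 0) :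
    (R.coeff 0).re = 0 ∧ ∀ k, 0 < k → R.coeff k = 0 := by
  -- On the circle `conj t = t⁻¹`, so `S` takes the value `t ^ N * 2 Re R(t)` there, with `N` the
  -- degree of `R`; it has infinitely many roots.
  set S : Polynomial ℂ := R * Polynomial.X ^ R.natDegree
    + (R.map (starRingEnd ℂ)).reflect R.natDegree
  have hS : S = 0 := by
    refine Polynomial.eq_zero_of_infinite_isRoot _ (Set.Infinite.mono ?_ (s := {t : ℂ | ‖t‖ = 1}) ?_)
    · intro t (ht : ‖t‖ = 1)
      have ht0 : t ≠ 0 := by rintro rfl; simp at ht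
      have hinv : t⁻¹ = starRingEnd ℂ t := Complex.inv_eq_conj ht
      have key : ((R.map (starRingEnd ℂ)).reflect R.natDegree).eval t
          = starRingEnd ℂ (R.eval t) * t ^ R.natDegree := by
        let _ : Invertible t⁻¹ := ⟨t, mul_inv_cancel₀ ht0, inv_mul_cancel₀ ht0⟩
        have h1 : ((R.map (starRingEnd ℂ)).reflect R.natDegree).eval t * t⁻¹ ^ R.natDegree
            = (R.map (starRingEnd ℂ)).eval t⁻¹ :=
          Polynomial.eval₂_reflect_mul_pow (RingHom.id ℂ) t⁻¹ R.natDegree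
            (R.map (starRingEnd ℂ)) (by simp)
        rw [hinv, Polynomial.eval_map, Polynomial.eval₂_hom, ← hinv, inv_pow] at h1
        rw [← h1, inv_mul_cancel_right₀ (pow_ne_zero _ ht0)]
      show S.eval t = 0
      rw [Polynomial.eval_add, key, Polynomial.eval_mul, Polynomial.eval_pow, Polynomial.eval_X,
        ← add_mul, Complex.add_conj, h t ht]
      simp
    · have : (Metric.sphere (0 : ℂ) 1).Infinite :=
        (isPreconnected_sphere (by simp) 0 1).infinite_of_nontrivial
          ⟨1, by simp, -1, by simp, by norm_num⟩
      simpa [Metric.sphere] using this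
  have hc : ∀ k, R.coeff k
      + ((R.map (starRingEnd ℂ)).reflect R.natDegree).coeff (k + R.natDegree) = 0 := by
    intro k
    have := congrArg (fun p => p.coeff (k + R.natDegree)) hS
    simpa [S, Polynomial.coeff_mul_X_pow] using this
  constructor
  · have := hc 0
    rw [zero_add, Polynomial.coeff_reflect, Polynomial.revAt_le le_rfl, Nat.sub_self,
      Polynomial.coeff_map] at this
    rw [Complex.add_conj] at this
    simpa using this
  · intro k hk
    have := hc k
    -- Indices above the degree are fixed by `revAt`, and the coefficients of `R` there are zero.
    rwa [Polynomial.coeff_reflect, Polynomial.revAt_eq_self_of_lt (by omega), Polynomial.coeff_map,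
      Polynomial.coeff_eq_zero_of_natDegree_lt (n := k + R.natDegree) (by omega), map_zero,
      add_zero] at this

/-- On the circle, `conj t * Q` equals `Q.divX` plus `conj t` times the constant term of `Q`, and
the latter has the same real part as `t` times the conjugate constant term. The hypothesis thus says
that an honest polynomial in `t` has zero real part on the circle. -/
lemma circle_coeff (P Q : Polynomial ℂ)
    (h : ∀ t : ℂ, ‖t‖ = 1 → (P.eval t).im = 2 * (starRingEnd ℂ t * Q.eval t).re) :
    (P.coeff 0).im = 2 * (Q.coeff 1).re ∧
      P.coeff 1 = 2 * Complex.I * (Q.coeff 2 + starRingEnd ℂ (Q.coeff 0)) := by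
  obtain ⟨h0, h1⟩ := coeff_of_re_eq_zero (-Polynomial.C Complex.I * P
    - 2 * Polynomial.C (starRingEnd ℂ (Q.coeff 0)) * Polynomial.X - 2 * Q.divX) (by
    intro t ht
    have hq : Q.eval t = Q.divX.eval t * t + Q.coeff 0 := by
      conv_lhs => rw [← Polynomial.divX_mul_X_add Q]
      simp
    have htt : starRingEnd ℂ t * t = 1 := by
      rw [mul_comm, Complex.mul_conj, Complex.normSq_eq_norm_sq, ht]; simp
    have h2 : starRingEnd ℂ t * Q.eval t = Q.divX.eval t + starRingEnd ℂ t * Q.coeff 0 := by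
      rw [hq, mul_add, ← mul_assoc, mul_right_comm, htt, one_mul]
    have := h t ht
    rw [h2] at this
    simp at this ⊢
    linarith)
  have h1 := h1 1 one_pos
  simp [mul_assoc, Polynomial.coeff_divX] at h0 h1
  exact ⟨by linarith, by linear_combination Complex.I * h1 + P.coeff 1 * Complex.I_mul_I⟩

end

/-! ### Tangency to the quadric and its splitting by degree in `z` -/

section

variable {n d : ℕ}

lemma star_dot_comm {M : Matrix (Fin n) (Fin n) ℂ} (hM : M.IsHermitian) (a b : Fin n → ℂ) :
    star b ⬝ᵥ (M *ᵥ a) = starRingEnd ℂ (star a ⬝ᵥ (M *ᵥ b)) := by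
  rw [starRingEnd_apply, ← Matrix.star_dotProduct_star, star_star, Matrix.star_mulVec, hM.eq,
    dotProduct_comm, ← Matrix.dotProduct_mulVec, dotProduct_comm]

lemma hermForm_add_smul {M : Matrix (Fin n) (Fin n) ℂ} (hM : M.IsHermitian) (z v : Fin n → ℂ)
    (t : ℝ) : hermForm M (z + t • v)
      = hermForm M z + t * (2 * (star z ⬝ᵥ (M *ᵥ v)).re) + t ^ 2 * hermForm M v := by
  have h1 : (t • v) = (t : ℂ) • v := by ext; simp
  have h2 : (star v ⬝ᵥ (M *ᵥ z)).re = (star z ⬝ᵥ (M *ᵥ v)).re := by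
    rw [star_dot_comm hM, Complex.conj_re]
  rw [h1]
  simp only [hermForm, Matrix.mulVec_add, Matrix.mulVec_smul, star_add, star_smul,
    add_dotProduct, dotProduct_add, smul_dotProduct, dotProduct_smul, smul_eq_mul, Complex.add_re,
    Complex.star_def, Complex.conj_ofReal, Complex.re_ofReal_mul, h2]
  ring

lemma hermForm_smul (M : Matrix (Fin n) (Fin n) ℂ) (t : ℂ) (z : Fin n → ℂ) :
    hermForm M (t • z) = ‖t‖ ^ 2 * hermForm M z := by
  simp only [hermForm, Matrix.mulVec_smul, star_smul, smul_dotProduct, dotProduct_smul,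
    smul_eq_mul, ← mul_assoc, Complex.star_def]
  rw [Complex.mul_conj']
  norm_cast
  rw [Complex.re_ofReal_mul]

lemma hermForm_eq {M : Matrix (Fin n) (Fin n) ℂ} (hM : M.IsHermitian) (z : Fin n → ℂ) :
    (hermForm M z : ℂ) = star z ⬝ᵥ (M *ᵥ z) :=
  Complex.conj_eq_iff_re.mp (star_dot_comm hM z z).symm

lemma fderiv_defFun {A : Fin d → Matrix (Fin n) (Fin n) ℂ} {l : Fin d} (hA : (A l).IsHermitian)
    (p v : Ambient n d) : fderiv ℝ (defFun A l) p v
      = (v.2 l).im - 2 * (star p.1 ⬝ᵥ (A l *ᵥ v.1)).re := by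
  have hd : DifferentiableAt ℝ (defFun A l) p := by
    have : defFun A l = fun p : Ambient n d => Complex.imCLM (p.2 l) -
        Complex.reCLM (∑ i, Complex.conjCLE (p.1 i) * ∑ j, A l i j * p.1 j) := by
      ext p
      simp [defFun, hermForm, dotProduct, Matrix.mulVec]
    rw [this]
    fun_prop
  rw [← hd.lineDeriv_eq_fderiv, lineDeriv]
  have : (fun t : ℝ => defFun A l (p + t • v)) = fun t : ℝ => defFun A l p +
      t * ((v.2 l).im - 2 * (star p.1 ⬝ᵥ (A l *ᵥ v.1)).re) - t ^ 2 * hermForm (A l) v.1 := by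
    ext t
    simp only [defFun, Prod.fst_add, Prod.snd_add, Prod.smul_fst, Prod.smul_snd,
      hermForm_add_smul hA, Pi.add_apply, Pi.smul_apply, Complex.add_im, Complex.smul_im,
      smul_eq_mul]
    ring
  rw [this]
  have h : HasDerivAt (fun t : ℝ => defFun A l p +
      t * ((v.2 l).im - 2 * (star p.1 ⬝ᵥ (A l *ᵥ v.1)).re) - t ^ 2 * hermForm (A l) v.1)
      (1 * ((v.2 l).im - 2 * (star p.1 ⬝ᵥ (A l *ᵥ v.1)).re)
        - (2 : ℕ) * (0 : ℝ) ^ (2 - 1) * hermForm (A l) v.1) 0 :=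
    (((hasDerivAt_id (0 : ℝ)).mul_const _).const_add _).sub ((hasDerivAt_pow 2 0).mul_const _)
  rw [h.deriv]
  simp

/-- Tangency to the quadric at every point, for polynomial fields. -/
def Tangent (A : Fin d → Matrix (Fin n) (Fin n) ℂ) (Y : PolyField n d) : Prop :=
  ∀ p ∈ quadric A, ∀ l, ((toMap Y p).2 l).im = 2 * (star p.1 ⬝ᵥ (A l *ᵥ (toMap Y p).1)).re

lemma smul_mem_quadric {A : Fin d → Matrix (Fin n) (Fin n) ℂ} {p : Ambient n d}
    (hp : p ∈ quadric A) (t : ℝ) : ((t : ℂ) • p.1, (t : ℂ) ^ 2 • p.2) ∈ quadric A := by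
  intro l
  have := hp l
  simp only [defFun, hermForm_smul] at this ⊢
  simp only [Complex.norm_real, Real.norm_eq_abs, sq_abs, Pi.smul_apply, smul_eq_mul,
    ← Complex.ofReal_pow, Complex.im_ofReal_mul]
  rw [← mul_sub, this, mul_zero]

/-- The coefficients of a polynomial field have (doubled) weights `a` and `a + 1`. -/
def HasNatWeight (a : ℕ) (Y : PolyField n d) : Prop :=
  (∀ j, MvPolynomial.IsWeightedHomogeneous (natWt n d) (Y (MvPolynomial.X (Sum.inl j))) a) ∧
  (∀ l, MvPolynomial.IsWeightedHomogeneous (natWt n d) (Y (MvPolynomial.X (Sum.inr l))) (a + 1))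

lemma HasWeight.natWeight {μ : ℚ} {Y : PolyField n d} (h : HasWeight μ Y) {a : ℕ}
    (ha : μ + 1 / 2 = a / 2) : HasNatWeight a Y :=
  ⟨fun j => isWeightedHomogeneous_natWt (h.1 j) ha,
    fun l => isWeightedHomogeneous_natWt (h.2 l) (by push_cast; linarith)⟩

/-- The quadric is stable under `(z, w) ↦ (t z, t² w)`, and the tangency expression scales by `t ^
(a + 1)`. Any point can be shrunk into the neighbourhood of `0` where tangency is given. -/
lemma tangent_of_mem_aut {A : Fin d → Matrix (Fin n) (Fin n) ℂ} (hA : ∀ l, (A l).IsHermitian)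
    {Y : PolyField n d} {a : ℕ} (hw : HasNatWeight a Y) (hY : toMap Y ∈ aut A) :
    Tangent A Y := by
  intro p hp l
  have htend : Filter.Tendsto (fun t : ℝ => (((t : ℂ) • p.1, (t : ℂ) ^ 2 • p.2) : Ambient n d))
      (𝓝[>] 0) (𝓝[quadric A] 0) := by
    refine tendsto_nhdsWithin_iff.mpr ⟨?_, Filter.Eventually.of_forall (smul_mem_quadric hp)⟩
    have hc : Continuous (fun t : ℝ => (((t : ℂ) • p.1, (t : ℂ) ^ 2 • p.2) : Ambient n d)) := by
      fun_prop
    have := hc.tendsto 0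
    simp only [Complex.ofReal_zero, zero_smul, ne_eq, OfNat.ofNat_ne_zero, not_false_eq_true,
      zero_pow] at this
    exact this.mono_left nhdsWithin_le_nhds
  obtain ⟨t, ht, ht0⟩ := ((htend.eventually hY.2).and self_mem_nhdsWithin).exists
  have ht0 : (0 : ℝ) < t := ht0
  have h := ht l
  rw [fderiv_defFun (hA l)] at h
  have h1 : (toMap Y ((t : ℂ) • p.1, (t : ℂ) ^ 2 • p.2)).1 = ((t ^ a : ℝ) : ℂ) • (toMap Y p).1 := by
    ext j
    simpa [toMap] using ev_smul (hw.1 j) t p.1 p.2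
  have h2 : (toMap Y ((t : ℂ) • p.1, (t : ℂ) ^ 2 • p.2)).2
      = ((t ^ (a + 1) : ℝ) : ℂ) • (toMap Y p).2 := by
    ext j
    simpa [toMap] using ev_smul (hw.2 j) t p.1 p.2
  rw [h1, h2] at h
  simp only [Pi.smul_apply, smul_eq_mul, Complex.im_ofReal_mul, star_smul, Complex.star_def,
    Complex.conj_ofReal, Matrix.mulVec_smul, smul_dotProduct, dotProduct_smul,
    Complex.re_ofReal_mul] at h
  have h3 : t ^ (a + 1) * (((toMap Y p).2 l).im
      - 2 * (star p.1 ⬝ᵥ (A l *ᵥ (toMap Y p).1)).re) = 0 := by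
    rw [← h]; ring
  have := (mul_eq_zero.mp h3).resolve_left (by positivity)
  linarith

/-- The part of degree `k` in `z` of the `∂/∂z`-coefficients. -/
noncomputable def zPart (Y : PolyField n d) (k : ℕ) (z : Fin n → ℂ) (w : Fin d → ℂ) : Fin n → ℂ :=
  fun j => (slice (Y (MvPolynomial.X (Sum.inl j))) z w).coeff k

/-- The part of degree `k` in `z` of the `∂/∂w`-coefficients. -/
noncomputable def wPart (Y : PolyField n d) (k : ℕ) (z : Fin n → ℂ) (w : Fin d → ℂ) : Fin d → ℂ :=
  fun l => (slice (Y (MvPolynomial.X (Sum.inr l))) z w).coeff k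

/-- The values of the Hermitian forms, as a point of `ℂᵈ`. -/
noncomputable def herm (A : Fin d → Matrix (Fin n) (Fin n) ℂ) (z : Fin n → ℂ) : Fin d → ℂ :=
  fun l => (hermForm (A l) z : ℂ)

/-- Rotating `z` by `t` on the unit circle keeps `(t z, w)` on the quadric, so `circle_coeff`
applies in the variable `t`; the two conclusions are its modes `0` and `1`. -/
lemma tangent_parts {A : Fin d → Matrix (Fin n) (Fin n) ℂ} {Y : PolyField n d} (hY : Tangent A Y)
    (z : Fin n → ℂ) (u : Fin d → ℝ) {w : Fin d → ℂ}
    (hw : w = fun l => (u l : ℂ) + Complex.I * herm A z l) (l : Fin d) :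
    (wPart Y 0 z w l).im = 2 * (star z ⬝ᵥ (A l *ᵥ zPart Y 1 z w)).re ∧
    wPart Y 1 z w l = 2 * Complex.I * (star z ⬝ᵥ (A l *ᵥ zPart Y 2 z w)
      + starRingEnd ℂ (star z ⬝ᵥ (A l *ᵥ zPart Y 0 z w))) := by
  set Q : Polynomial ℂ := ∑ i, Polynomial.C ((star z ᵥ* A l) i) *
    slice (Y (MvPolynomial.X (Sum.inl i))) z w
  have hQ : ∀ k, Q.coeff k = star z ⬝ᵥ (A l *ᵥ zPart Y k z w) := by
    intro k
    rw [Matrix.dotProduct_mulVec]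
    simp [Q, Polynomial.finsetSum_coeff, dotProduct, zPart]
  rw [← hQ, ← hQ, ← hQ]
  refine circle_coeff (slice (Y (MvPolynomial.X (Sum.inr l))) z w) Q fun t ht => ?_
  have hmem : ((t • z, w) : Ambient n d) ∈ quadric A := by
    intro k
    simp [defFun, hermForm_smul, ht, hw, herm]
  have := hY _ hmem l
  rw [eval_slice]
  refine this.trans ?_
  congr 2
  change star (t • z) ⬝ᵥ _ = _
  rw [star_smul, smul_dotProduct, Matrix.dotProduct_mulVec, smul_eq_mul]
  simp [Q, Polynomial.eval_finsetSum, dotProduct, eval_slice, toMap]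

end

/-! ### Polarization and generic independence of the two forms -/

section

variable {n : ℕ}

lemma differentiable_ev {d : ℕ} (f : Poly n d) (z : Fin n → ℂ) :
    Differentiable ℂ (fun w => ev z w f) := by
  induction f using MvPolynomial.induction_on with
  | C a => simp
  | add p q hp hq =>
    simp only [map_add]
    exact hp.add hq
  | mul_X p i hp =>
    simp only [map_mul]
    refine hp.mul ?_
    rcases i with i | i
    · simp
    · simp only [MvPolynomial.eval_X, Sum.elim_inr]
      fun_prop

/-- A holomorphic function of `(z, ζ)` vanishing for `ζ = z̄` vanishes identically. -/
lemma polarize {f : (Fin n → ℂ) → (Fin n → ℂ) → ℂ}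
    (hf : Differentiable ℂ (fun p : (Fin n → ℂ) × (Fin n → ℂ) => f p.1 p.2))
    (h : ∀ z, f z (star z) = 0) (z ζ : Fin n → ℂ) : f z ζ = 0 := by
  set x : Fin n → ℂ := fun i => (((z i + ζ i) / 2).re : ℂ)
  set x' : Fin n → ℂ := fun i => (((z i + ζ i) / 2).im : ℂ)
  set y : Fin n → ℂ := fun i => (((z i - ζ i) / (2 * Complex.I)).re : ℂ)
  set y' : Fin n → ℂ := fun i => (((z i - ζ i) / (2 * Complex.I)).im : ℂ)
  -- For real `t` the two arguments are conjugate, so `g` vanishes on the real line and hence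
  -- everywhere; at `t = i` the arguments are `z` and `ζ`.
  set g : ℂ → ℂ := fun t => f ((x + t • x') + Complex.I • (y + t • y'))
    ((x + t • x') - Complex.I • (y + t • y'))
  have hg : Differentiable ℂ g := by
    have h2 : Differentiable ℂ (fun t : ℂ => ((x + t • x') + Complex.I • (y + t • y'),
      (x + t • x') - Complex.I • (y + t • y'))) := by fun_prop
    exact hf.comp h2
  have hreal : ∀ t : ℝ, g t = 0 := by
    intro t
    have : (x + (t : ℂ) • x') - Complex.I • (y + (t : ℂ) • y')
        = star ((x + (t : ℂ) • x') + Complex.I • (y + (t : ℂ) • y')) := by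
      ext i
      simp only [x, x', y, y', Pi.sub_apply, Pi.add_apply, Pi.smul_apply, Pi.star_apply,
        smul_eq_mul, Complex.star_def, map_add, map_mul, Complex.conj_I, Complex.conj_ofReal]
      ring
    simp only [g, this, h]
  have hg0 : g = 0 := by
    refine AnalyticOnNhd.eq_of_frequently_eq (z₀ := 0) (fun t _ => hg.analyticAt t)
      analyticOnNhd_const ?_
    have ht : Filter.Tendsto (fun t : ℝ => (t : ℂ)) (𝓝[≠] 0) (𝓝[≠] 0) := by
      refine tendsto_nhdsWithin_iff.mpr ⟨?_, ?_⟩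
      · exact (Complex.continuous_ofReal.tendsto' 0 0 (by simp)).mono_left nhdsWithin_le_nhds
      · filter_upwards [self_mem_nhdsWithin] with t ht
        simpa using ht
    exact ht.frequently (Filter.Eventually.of_forall hreal).frequently
  have h1 : g Complex.I = 0 := congrFun hg0 Complex.I
  have e1 : ∀ c : ℂ, (c.re : ℂ) + Complex.I * c.im = c := fun c => by
    rw [mul_comm]; exact Complex.re_add_im c
  have hx : x + Complex.I • x' = fun i => (z i + ζ i) / 2 := by
    ext i
    simp only [x, x', Pi.add_apply, Pi.smul_apply, smul_eq_mul, e1]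
  have hy : y + Complex.I • y' = fun i => (z i - ζ i) / (2 * Complex.I) := by
    ext i
    simp only [y, y', Pi.add_apply, Pi.smul_apply, smul_eq_mul, e1]
  have hz : (x + Complex.I • x') + Complex.I • (y + Complex.I • y') = z := by
    rw [hx, hy]
    ext i
    simp only [Pi.add_apply, Pi.smul_apply, smul_eq_mul]
    field_simp
    ring
  have hζ : (x + Complex.I • x') - Complex.I • (y + Complex.I • y') = ζ := by
    rw [hx, hy]
    ext i
    simp only [Pi.sub_apply, Pi.smul_apply, smul_eq_mul]
    field_simp
    ring
  simpa only [g, hz, hζ] using h1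

/-- If a product of holomorphic functions vanishes, one of the factors vanishes. -/
lemma eq_zero_of_mul_eq_zero {E : Type*} [NormedAddCommGroup E] [NormedSpace ℂ E] {f g : E → ℂ}
    (hf : Differentiable ℂ f) (hg : Differentiable ℂ g) (h : ∀ x, f x * g x = 0) {x₀ : E}
    (h0 : f x₀ ≠ 0) (x : E) : g x = 0 := by
  -- Restriction to the complex line through `x₀` and `x` reduces the claim to one variable.
  have hl : Differentiable ℂ (fun t : ℂ => x₀ + t • (x - x₀)) := by fun_prop
  rcases AnalyticOnNhd.eq_zero_or_eq_zero_of_mul_eq_zero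
    (f := fun t : ℂ => f (x₀ + t • (x - x₀))) (g := fun t : ℂ => g (x₀ + t • (x - x₀)))
    (U := Set.univ) (fun t _ => (hf.comp hl).analyticAt t) (fun t _ => (hg.comp hl).analyticAt t)
    (fun t _ => h _) isPreconnected_univ with h1 | h1
  · exact absurd (by simpa using h1 0 trivial) h0
  · simpa using h1 1 trivial

/-- The bilinear form with matrix `M`. -/
noncomputable def bil (M : Matrix (Fin n) (Fin n) ℂ) (ζ z : Fin n → ℂ) : ℂ := ζ ⬝ᵥ (M *ᵥ z)

lemma bil_add_right (M : Matrix (Fin n) (Fin n) ℂ) (ζ z z' : Fin n → ℂ) :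
    bil M ζ (z + z') = bil M ζ z + bil M ζ z' := by simp [bil, Matrix.mulVec_add]

lemma bil_smul_right (M : Matrix (Fin n) (Fin n) ℂ) (ζ z : Fin n → ℂ) (c : ℂ) :
    bil M ζ (c • z) = c * bil M ζ z := by simp [bil, Matrix.mulVec_smul]

lemma bil_smul_left (M : Matrix (Fin n) (Fin n) ℂ) (ζ z : Fin n → ℂ) (c : ℂ) :
    bil (c • M) ζ z = c * bil M ζ z := by simp [bil, Matrix.smul_mulVec]

lemma ext_bil {M N : Matrix (Fin n) (Fin n) ℂ} (h : ∀ ζ z, bil M ζ z = bil N ζ z) : M = N := by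
  ext i j
  simpa [bil] using h (Pi.single i 1) (Pi.single j 1)

lemma exists_bil_ne_zero {M : Matrix (Fin n) (Fin n) ℂ} (h : M ≠ 0) : ∃ ζ z, bil M ζ z ≠ 0 := by
  by_contra! hc
  exact h (ext_bil fun ζ z => by rw [hc]; simp [bil])

lemma bil_conjTranspose (M : Matrix (Fin n) (Fin n) ℂ) (ζ z : Fin n → ℂ) :
    bil Mᴴ (star z) (star ζ) = starRingEnd ℂ (bil M ζ z) := by
  rw [bil, bil, starRingEnd_apply, ← Matrix.star_dotProduct_star, Matrix.star_mulVec,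
    ← Matrix.dotProduct_mulVec]

lemma bil_conj {M : Matrix (Fin n) (Fin n) ℂ} (hM : M.IsHermitian) (ζ z : Fin n → ℂ) :
    bil M (star z) (star ζ) = starRingEnd ℂ (bil M ζ z) := by
  rw [← bil_conjTranspose, hM.eq]

@[fun_prop]
lemma differentiable_bil {E : Type*} [NormedAddCommGroup E] [NormedSpace ℂ E]
    (M : Matrix (Fin n) (Fin n) ℂ) {f g : E → Fin n → ℂ} (hf : Differentiable ℂ f)
    (hg : Differentiable ℂ g) : Differentiable ℂ (fun x => bil M (f x) (g x)) := by
  simp only [bil, dotProduct, Matrix.mulVec]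
  fun_prop

/-- If the bilinear forms of `M` and `N` are proportional in each variable, they are
proportional. -/
lemma exists_eq_smul {M N : Matrix (Fin n) (Fin n) ℂ} (hN : N ≠ 0)
    (h1 : ∀ ζ z z', bil M ζ z * bil N ζ z' = bil M ζ z' * bil N ζ z)
    (h2 : ∀ ζ ζ' z, bil M ζ z * bil N ζ' z = bil M ζ' z * bil N ζ z) : ∃ c : ℂ, M = c • N := by
  obtain ⟨ζ₀, z₀, h0⟩ := exists_bil_ne_zero hN
  set c := bil M ζ₀ z₀ / bil N ζ₀ z₀
  have hc : c * bil N ζ₀ z₀ = bil M ζ₀ z₀ := div_mul_cancel₀ _ h0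
  have hrow : ∀ z, bil M ζ₀ z = c * bil N ζ₀ z := fun z =>
    mul_right_cancel₀ h0 (by rw [h1 ζ₀ z z₀, ← hc]; ring)
  have hgen : ∀ ζ z, bil N ζ₀ z ≠ 0 → bil M ζ z = c * bil N ζ z := fun ζ z hz =>
    mul_right_cancel₀ hz (by rw [h2 ζ ζ₀ z, hrow]; ring)
  refine ⟨c, ext_bil fun ζ z => ?_⟩
  rw [bil_smul_left]
  -- When `z` is degenerate, `z + z₀` is not, and the identity at `z₀` is subtracted.
  by_cases hz : bil N ζ₀ z = 0
  · have h3 := hgen ζ (z + z₀) (by rwa [bil_add_right, hz, zero_add])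
    rw [bil_add_right, bil_add_right, hgen ζ z₀ h0] at h3
    linear_combination h3
  · exact hgen ζ z hz

variable {A : Fin 2 → Matrix (Fin n) (Fin n) ℂ}

/-- The determinant measuring the independence of `ζ A₀`, `ζ A₁` on `z`, `z'`. -/
noncomputable def rowDet (A : Fin 2 → Matrix (Fin n) (Fin n) ℂ) (ζ z z' : Fin n → ℂ) : ℂ :=
  bil (A 0) ζ z * bil (A 1) ζ z' - bil (A 0) ζ z' * bil (A 1) ζ z

lemma real_combination {c₀ c₁ : ℝ} (hA : LinearIndependent ℝ A)
    (h : (c₀ : ℂ) • A 0 + (c₁ : ℂ) • A 1 = 0) : c₀ = 0 ∧ c₁ = 0 := by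
  have := Fintype.linearIndependent_iff.mp hA ![c₀, c₁] (by
    rw [Fin.sum_univ_two]
    simpa using h)
  exact ⟨by simpa using this 0, by simpa using this 1⟩

/-- Otherwise the two forms are proportional in `z` and, by Hermitian symmetry, in `ζ`. Then `A 1 =
c • A 0`, with `c` real because both matrices are Hermitian, against independence over `ℝ`. -/
lemma exists_rowDet_ne_zero (hA : Nondegenerate A) : ∃ ζ z z', rowDet A ζ z z' ≠ 0 := by
  by_contra! hc
  have h1 : ∀ ζ z z', bil (A 1) ζ z * bil (A 0) ζ z' = bil (A 1) ζ z' * bil (A 0) ζ z := by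
    intro ζ z z'
    have := hc ζ z z'
    rw [rowDet] at this
    linear_combination -this
  have h2 : ∀ ζ ζ' z, bil (A 1) ζ z * bil (A 0) ζ' z = bil (A 1) ζ' z * bil (A 0) ζ z := by
    intro ζ ζ' z
    have := congrArg (starRingEnd ℂ) (h1 (star z) (star ζ) (star ζ'))
    simpa only [map_mul, ← bil_conj (hA.isHermitian _), star_star] using this
  have hA0 : A 0 ≠ 0 := hA.linearIndependent.ne_zero 0
  obtain ⟨c, hcA⟩ := exists_eq_smul hA0 h1 h2
  have hconj : c = starRingEnd ℂ c := by
    have h3 := (hA.isHermitian 1).eq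
    rw [hcA, Matrix.conjTranspose_smul, (hA.isHermitian 0).eq, ← sub_eq_zero, ← sub_smul] at h3
    have := (smul_eq_zero.mp h3).resolve_right hA0
    exact (sub_eq_zero.mp this).symm
  obtain ⟨r, rfl⟩ := Complex.conj_eq_iff_real.mp hconj.symm
  have := (real_combination (c₀ := r) (c₁ := -1) hA.linearIndependent (by rw [hcA]; simp)).2
  norm_num at this

lemma exists_bil_eq {ζ z z' : Fin n → ℂ} (h : rowDet A ζ z z' ≠ 0) (w : Fin 2 → ℂ) :
    ∃ y, ∀ l, bil (A l) ζ y = w l := by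
  -- Cramer's rule in the span of `z` and `z'`.
  refine ⟨((w 0 * bil (A 1) ζ z' - w 1 * bil (A 0) ζ z') / rowDet A ζ z z') • z +
    ((w 1 * bil (A 0) ζ z - w 0 * bil (A 1) ζ z) / rowDet A ζ z z') • z', fun l => ?_⟩
  rw [bil_add_right, bil_smul_right, bil_smul_right]
  field_simp
  fin_cases l
  · simp only [rowDet, Fin.zero_eta]; ring
  · simp only [rowDet, Fin.mk_one]; ring

lemma herm_eq_bil (hA : Nondegenerate A) (z : Fin n → ℂ) :
    herm A z = fun l => bil (A l) (star z) z :=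
  funext fun l => hermForm_eq (hA.isHermitian l) z

lemma eq_zero_of_herm_eq_zero (hA : Nondegenerate A) {g : (Fin 2 → ℂ) → ℂ}
    (hg : Differentiable ℂ g) (h : ∀ z, g (herm A z) = 0) (w : Fin 2 → ℂ) : g w = 0 := by
  obtain ⟨ζ, z, z', hd⟩ := exists_rowDet_ne_zero hA
  obtain ⟨y, hy⟩ := exists_bil_eq hd w
  have := polarize (f := fun z ζ => g (fun l => bil (A l) ζ z))
    (hg.comp (f := fun p : (Fin n → ℂ) × (Fin n → ℂ) => fun l => bil (A l) p.2 p.1)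
      (by fun_prop)) (fun z => by rw [← herm_eq_bil hA, h]) y ζ
  simpa only [hy] using this

/-- After polarization, every generic `ζ` admits `y` whose pair of values `ζ A_l y` is the given
`w`, so `ζ A_l F(w) = 0` for generic and then all `ζ`. The trivial common kernel finishes. -/
lemma eq_zero_of_bil_herm_eq_zero (hA : Nondegenerate A) {F : (Fin 2 → ℂ) → Fin n → ℂ}
    (hF : Differentiable ℂ F) (h : ∀ z l, star z ⬝ᵥ (A l *ᵥ F (herm A z)) = 0)
    (w : Fin 2 → ℂ) : F w = 0 := by
  obtain ⟨ζ₀, z, z', hd⟩ := exists_rowDet_ne_zero hA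
  have hpol : ∀ l ζ y, bil (A l) ζ (F (fun l => bil (A l) ζ y)) = 0 := fun l ζ y =>
    polarize (f := fun z ζ => bil (A l) ζ (F (fun l => bil (A l) ζ z)))
      (differentiable_bil _ (by fun_prop)
        (hF.comp (f := fun p : (Fin n → ℂ) × (Fin n → ℂ) => fun l => bil (A l) p.2 p.1)
          (by fun_prop)))
      (fun z => by rw [← herm_eq_bil hA]; exact h z l) y ζ
  refine hA.ker_inter _ fun l => ?_
  have hz : ∀ ζ, bil (A l) ζ (F w) = 0 := by
    refine eq_zero_of_mul_eq_zero (f := fun ζ => rowDet A ζ z z') (x₀ := ζ₀)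
      (by unfold rowDet; fun_prop) (by fun_prop) (fun ζ => ?_) hd
    by_cases hζ : rowDet A ζ z z' = 0
    · rw [hζ, zero_mul]
    · obtain ⟨y, hy⟩ := exists_bil_eq hζ w
      have := hpol l ζ y
      simp only [hy] at this
      rw [this, mul_zero]
  ext i
  simpa [bil] using hz (Pi.single i 1)

end

/-! ### The matrix argument for weight `1` -/

section

variable {n : ℕ} {A : Fin 2 → Matrix (Fin n) (Fin n) ℂ}

lemma conjTranspose_of_re_eq_zero {M : Matrix (Fin n) (Fin n) ℂ}
    (h : ∀ z, (bil M (star z) z).re = 0) : Mᴴ = -M := by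
  have hp : ∀ z ζ, bil M ζ z + bil Mᴴ ζ z = 0 :=
    polarize (f := fun z ζ => bil M ζ z + bil Mᴴ ζ z) (by fun_prop) fun z => by
      have := bil_conjTranspose M (star z) z
      rw [star_star] at this
      rw [this, Complex.add_conj, h]
      simp
  refine ext_bil fun ζ z => ?_
  rw [show -M = (-1 : ℂ) • M by simp, bil_smul_left]
  linear_combination hp z ζ

/-- If `A₀ M₀ + A₁ M₁ = 0` as products of bilinear forms, and the rows of `A₀`, `A₁` are generically
independent, then the rows of `M₀` are proportional to those of `A₁`. -/
lemma row_proportional {M₀ M₁ : Matrix (Fin n) (Fin n) ℂ} {ζ₀ y y' : Fin n → ℂ}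
    (hd : rowDet A ζ₀ y y' ≠ 0)
    (h : ∀ ζ z, bil (A 0) ζ z * bil M₀ ζ z + bil (A 1) ζ z * bil M₁ ζ z = 0) (ζ z z' : Fin n → ℂ) :
    bil M₀ ζ z * bil (A 1) ζ z' = bil M₀ ζ z' * bil (A 1) ζ z := by
  rw [← sub_eq_zero]
  refine eq_zero_of_mul_eq_zero (f := fun ζ => rowDet A ζ y y') (x₀ := ζ₀)
    (g := fun ζ => bil M₀ ζ z * bil (A 1) ζ z' - bil M₀ ζ z' * bil (A 1) ζ z)
    (by unfold rowDet; fun_prop) (by fun_prop) (fun ζ => ?_) hd ζ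
  by_cases hζ : rowDet A ζ y y' = 0
  · rw [hζ, zero_mul]
  -- With `ζ A_0 x = 1` and `ζ A_1 x = 0`, the relation at `x` gives `ζ M₀ x = 0`. Subtracting the
  -- relation at `v` from that at `v + x` exhibits `ζ M₀` as a multiple of `ζ A_1`.
  obtain ⟨x, hx⟩ := exists_bil_eq hζ ![1, 0]
  have h0 : bil (A 0) ζ x = 1 := hx 0
  have h1 : bil (A 1) ζ x = 0 := hx 1
  have hM : bil M₀ ζ x = 0 := by simpa [h0, h1] using h ζ x
  have key : ∀ v, bil M₀ ζ v = -bil (A 1) ζ v * bil M₁ ζ x := by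
    intro v
    have := h ζ (v + x)
    simp only [bil_add_right, h0, h1, hM] at this
    linear_combination this - h ζ v
  rw [key z, key z']
  ring

lemma exists_skew_eq_smul {N M : Matrix (Fin n) (Fin n) ℂ} (hN : N.IsHermitian) (hN0 : N ≠ 0)
    (hM : Mᴴ = -M) (h1 : ∀ ζ z z', bil M ζ z * bil N ζ z' = bil M ζ z' * bil N ζ z) :
    ∃ c : ℂ, M = c • N := by
  refine exists_eq_smul hN0 h1 fun ζ ζ' z => ?_
  have hMc : ∀ ζ z, starRingEnd ℂ (bil M ζ z) = -bil M (star z) (star ζ) := fun ζ z => by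
    rw [← bil_conjTranspose, hM, show -M = (-1 : ℂ) • M by simp, bil_smul_left, neg_one_mul]
  have := congrArg (starRingEnd ℂ) (h1 (star z) (star ζ) (star ζ'))
  simp only [map_mul, hMc, ← bil_conj hN, star_star] at this
  linear_combination -this

lemma eq_zero_of_mul_matrices (hA : Nondegenerate A) {N : Matrix (Fin n) (Fin n) ℂ}
    (h : ∀ l, A l * N = 0) : N = 0 := by
  refine ext_bil fun ζ z => ?_
  have : N *ᵥ z = 0 := hA.ker_inter _ fun l => by rw [Matrix.mulVec_mulVec, h, Matrix.zero_mulVec]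
  simp [bil, this]

/-- Generic independence turns the polarized quartic relation into `A_l B_0 = c_l A_1` and `A_l B_1
= -c_l A_0` with `c_l` imaginary. Suitable combinations `N` of the `A_l` and `E` of the `B_l` then
satisfy `c_l c_k N = 0`; a nonzero `c_l` would make `N = 0` a real dependence between `A_0` and
`A_1`. -/
lemma matrices_eq_zero (hA : Nondegenerate A) (B : Fin 2 → Matrix (Fin n) (Fin n) ℂ)
    (h1 : ∀ k l z, (bil (A l * B k) (star z) z).re = 0)
    (h2 : ∀ l z, ∑ k, herm A z k * bil (A l * B k) (star z) z = 0) (k : Fin 2) : B k = 0 := by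
  obtain ⟨ζ₀, y, y', hd⟩ := exists_rowDet_ne_zero hA
  have hskew : ∀ k l, (A l * B k)ᴴ = -(A l * B k) := fun k l => conjTranspose_of_re_eq_zero (h1 k l)
  have hrel : ∀ l ζ z, bil (A 0) ζ z * bil (A l * B 0) ζ z
      + bil (A 1) ζ z * bil (A l * B 1) ζ z = 0 := fun l ζ z =>
    polarize (f := fun z ζ => bil (A 0) ζ z * bil (A l * B 0) ζ z
      + bil (A 1) ζ z * bil (A l * B 1) ζ z) (by fun_prop) (fun z => by
      have := h2 l z
      rwa [herm_eq_bil hA, Fin.sum_univ_two] at this) z ζ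
  have hA0 : ∀ l, A l ≠ 0 := hA.linearIndependent.ne_zero
  have e0 : ∀ l, ∃ c : ℂ, A l * B 0 = c • A 1 := fun l =>
    exists_skew_eq_smul (hA.isHermitian 1) (hA0 1) (hskew 0 l) (row_proportional hd (hrel l))
  have e1 : ∀ l, ∃ c : ℂ, A l * B 1 = c • A 0 := fun l =>
    exists_skew_eq_smul (hA.isHermitian 0) (hA0 0) (hskew 1 l)
      (row_proportional (A := ![A 1, A 0]) (M₁ := A l * B 0) (ζ₀ := ζ₀) (y := y) (y' := y')
        (by
          intro h
          apply hd
          simp only [rowDet, Matrix.cons_val_zero, Matrix.cons_val_one] at h ⊢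
          linear_combination -h)
        (fun ζ z => by simpa [add_comm] using hrel l ζ z))
  choose c hc using e0
  choose c' hc' using e1
  -- The quartic relation is evaluated where both forms equal `1`.
  obtain rfl : c' = -c := by
    obtain ⟨x, hx⟩ := exists_bil_eq hd ![1, 1]
    have hx0 : bil (A 0) ζ₀ x = 1 := hx 0
    have hx1 : bil (A 1) ζ₀ x = 1 := hx 1
    ext l
    have := hrel l ζ₀ x
    rw [hc, hc', bil_smul_left, bil_smul_left, hx0, hx1] at this
    simp only [Pi.neg_apply]
    linear_combination this
  have him : ∀ l, starRingEnd ℂ (c l) = -c l := by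
    intro l
    have := hskew 0 l
    rw [hc, Matrix.conjTranspose_smul, (hA.isHermitian 1).eq, ← neg_smul, ← sub_eq_zero,
      ← sub_smul] at this
    exact sub_eq_zero.mp ((smul_eq_zero.mp this).resolve_right (hA0 1))
  -- `N` annihilates both `B k`, and `A l * E = c l • N`
  set N := c 0 • A 1 - c 1 • A 0 with hN
  set E := c 0 • B 0 + c 1 • B 1 with hE
  have hNB : ∀ k, N * B k = 0 := by
    intro k
    fin_cases k
    · simp [hN, sub_mul, hc, smul_smul, mul_comm]
    · simp [hN, sub_mul, hc', smul_smul, mul_comm]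
  have hAE : ∀ l, A l * E = c l • N := by
    intro l
    simp only [hE, hN, mul_add, Matrix.mul_smul, hc, hc', Pi.neg_apply, smul_sub, smul_smul]
    module
  have hEB : ∀ k, E * B k = 0 := fun k => eq_zero_of_mul_matrices hA fun l => by
    rw [← Matrix.mul_assoc, hAE, Matrix.smul_mul, hNB, smul_zero]
  have hNstar : Nᴴ = -N := by
    simp only [hN, Matrix.conjTranspose_sub, Matrix.conjTranspose_smul, (hA.isHermitian _).eq,
      Complex.star_def, him]
    module
  have hEA : ∀ l, Eᴴ * A l = A l * E := by
    intro l
    rw [← (hA.isHermitian l).eq, ← Matrix.conjTranspose_mul, (hA.isHermitian l).eq, hAE,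
      Matrix.conjTranspose_smul, hNstar, Complex.star_def, him]
    module
  have hEAB : ∀ l k, Eᴴ * (A l * B k) = 0 := fun l k => by
    rw [← Matrix.mul_assoc, hEA, Matrix.mul_assoc, hEB, Matrix.mul_zero]
  -- `c_k N = A_k E = Eᴴ A_k`, while `c_l A_k` is, up to sign, `A_l` times the other `B`, which `Eᴴ`
  -- annihilates.
  have hcN : ∀ l k, (c l * c k) • N = 0 := by
    intro l k
    rw [mul_smul, ← hAE, ← hEA]
    fin_cases k
    · have := hEAB l 1
      rw [hc', Matrix.mul_smul, Pi.neg_apply, neg_smul, neg_eq_zero] at this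
      exact this
    · have := hEAB l 0
      rw [hc, Matrix.mul_smul] at this
      exact this
  have hc0 : ∀ l, c l = 0 := by
    by_contra! hne
    obtain ⟨l, hl⟩ := hne
    have hN0 : N = 0 := (smul_eq_zero.mp (hcN l l)).resolve_left (mul_ne_zero hl hl)
    have hci : ∀ l, c l = Complex.I * ((c l).im : ℂ) := by
      intro l
      have hre : (c l).re = 0 := by
        have := congrArg Complex.re (him l)
        simp at this
        linarith
      apply Complex.ext <;> simp [hre]
    have : ((c 1).im : ℂ) • A 0 + ((-(c 0).im : ℝ) : ℂ) • A 1 = 0 := by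
      have h3 : Complex.I • N = 0 := by rw [hN0, smul_zero]
      rw [← h3, hN, hci 0, hci 1, smul_sub, smul_smul, smul_smul, ← mul_assoc, ← mul_assoc,
        Complex.I_mul_I]
      push_cast
      simp
      module
    obtain ⟨r1, r0⟩ := real_combination hA.linearIndependent this
    apply hl
    rw [hci l]
    fin_cases l
    · simp [neg_eq_zero.mp r0]
    · simp [r1]
  refine eq_zero_of_mul_matrices hA fun l => ?_
  fin_cases k
  · simp [hc, hc0]
  · simp [hc', hc0]

end

/-! ### Brackets with `W_l`, rigid fields, and the weights `2` and `3/2` -/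

section

variable {n d : ℕ}

lemma bracket_W_apply (Y : PolyField n d) (l : Fin d) (c : Fin n ⊕ Fin d) :
    ⁅Y, W l⁆ (MvPolynomial.X c) = -MvPolynomial.pderiv (Sum.inr l) (Y (MvPolynomial.X c)) := by
  classical
  have h : Y ((W l : PolyField n d) (MvPolynomial.X c)) = 0 := by
    rw [W, MvPolynomial.pderiv_X]
    rcases eq_or_ne (Sum.inr l) c with rfl | hc
    · simp
    · simp [hc.symm]
  rw [Derivation.commutator_apply, h, zero_sub, W]

lemma bracketW_induction {P : PolyField n d → Prop} (hP : ∀ Z l, P Z → P ⁅Z, W l⁆)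
    {Y : PolyField n d}
    (hY : P Y) (l : Fin d) (k : ℕ) : P (bracketW l k Y) := by
  induction k with
  | zero => exact hY
  | succ k ih =>
    rw [bracketW, Function.iterate_succ_apply']
    exact hP _ _ ih

lemma multiBracket_two (k : Fin 2 → ℕ) (Y : PolyField n 2) :
    multiBracket k Y = bracketW 0 (k 0) (bracketW 1 (k 1) Y) := rfl

lemma multiBracket_induction {P : PolyField n 2 → Prop} (hP : ∀ Z l, P Z → P ⁅Z, W l⁆)
    {Y : PolyField n 2} (hY : P Y) (k : Fin 2 → ℕ) : P (multiBracket k Y) := by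
  rw [multiBracket_two]
  exact bracketW_induction hP (bracketW_induction hP hY 1 _) 0 _

lemma field_eq_zero {Y : PolyField n d} (h1 : ∀ j, Y (MvPolynomial.X (Sum.inl j)) = 0)
    (h2 : ∀ l, Y (MvPolynomial.X (Sum.inr l)) = 0) : Y = 0 :=
  MvPolynomial.derivation_ext (by rintro (j | l) <;> simp [h1, h2])

lemma bracketW_hasWeight {μ : ℚ} {Y : PolyField n d} (h : HasWeight μ Y) (l : Fin d) (k : ℕ) :
    HasWeight (μ - k) (bracketW l k Y) := by
  induction k with
  | zero => simpa [bracketW] using h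
  | succ k ih =>
    rw [bracketW, Function.iterate_succ_apply', ← bracketW]
    constructor
    · intro j
      rw [bracket_W_apply, ← MvPolynomial.mem_weightedHomogeneousSubmodule]
      refine neg_mem (MvPolynomial.IsWeightedHomogeneous.pderiv (ih.1 j) ?_)
      simp only [wt, Sum.elim_inr]
      push_cast
      ring
    · intro j
      rw [bracket_W_apply, ← MvPolynomial.mem_weightedHomogeneousSubmodule]
      refine neg_mem (MvPolynomial.IsWeightedHomogeneous.pderiv (ih.2 j) ?_)
      simp only [wt, Sum.elim_inr]
      push_cast
      ring

lemma multiBracket_hasWeight {μ : ℚ} {Y : PolyField n 2} (h : HasWeight μ Y) (k : Fin 2 → ℕ) :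
    HasWeight (μ - (∑ l, k l : ℕ)) (multiBracket k Y) := by
  rw [multiBracket_two]
  have := bracketW_hasWeight (bracketW_hasWeight h 1 (k 1)) 0 (k 0)
  convert this using 1
  rw [Fin.sum_univ_two]
  push_cast
  ring

lemma eq_zero_of_ev {f : Poly n d} (h : ∀ z w, ev z w f = 0) : f = 0 :=
  MvPolynomial.funext fun x => by
    have := h (x ∘ Sum.inl) (x ∘ Sum.inr)
    rwa [ev, Sum.elim_comp_inl_inr] at this

lemma eq_C_of_weight_zero {f : Poly n d}
    (hf : MvPolynomial.IsWeightedHomogeneous (natWt n d) f 0) : f = MvPolynomial.C (ev 0 0 f) := by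
  rw [← sub_eq_zero]
  refine eq_zero_of_ev fun z w => ?_
  rw [map_sub, ev_eq_of_weight_zero hf z w]
  simp

/-- A field of weight `-1` with real constant coefficients is a rigid infinitesimal
automorphism. -/
lemma mem_GR_of_real {A : Fin d → Matrix (Fin n) (Fin n) ℂ} (hA : ∀ l, (A l).IsHermitian)
    {X : PolyField n d} (hX : HasWeight (-1) X)
    (hr : ∀ l, (ev 0 0 (X (MvPolynomial.X (Sum.inr l)))).im = 0) : X ∈ GR A (-1) := by
  have h1 : ∀ j, X (MvPolynomial.X (Sum.inl j)) = 0 := fun j =>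
    eq_zero_of_weight_neg (hX.1 j) (by norm_num)
  have h2 : ∀ l, X (MvPolynomial.X (Sum.inr l))
      = MvPolynomial.C (ev 0 0 (X (MvPolynomial.X (Sum.inr l)))) := fun l =>
    eq_C_of_weight_zero (isWeightedHomogeneous_natWt (hX.2 l) (by norm_num))
  have hmap : toMap X = fun _ => (0, fun l => ev 0 0 (X (MvPolynomial.X (Sum.inr l)))) := by
    funext p
    refine Prod.ext (funext fun j => ?_) (funext fun l => ?_)
    · simp [toMap, h1]
    · simp only [toMap]
      rw [h2 l, MvPolynomial.eval_C, MvPolynomial.eval_C]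
  refine ⟨⟨hX, ?_, ?_⟩, ?_⟩
  · rw [hmap]
    exact analyticAt_const
  · refine Filter.Eventually.of_forall fun p l => ?_
    rw [fderiv_defFun (hA l), hmap]
    simp [hr]
  · rintro (j | l) m
    · simp [h1]
    · rw [h2, MvPolynomial.vars_C]
      simp

lemma Tangent.im_ev_zero {A : Fin d → Matrix (Fin n) (Fin n) ℂ} {Y : PolyField n d}
    (hY : Tangent A Y) (l : Fin d) (u : Fin d → ℝ) :
    (ev 0 (fun l => (u l : ℂ)) (Y (MvPolynomial.X (Sum.inr l)))).im = 0 := by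
  have := hY (0, fun l => (u l : ℂ)) (fun l => by simp [defFun, hermForm]) l
  simpa [toMap] using this

/-- A bracket of total weight `-1` is a constant field in the `w`-directions. Tangency at `z = 0`
makes the `∂/∂w`-coefficients real at real `w`, and `w`-derivatives keep this, so the constants are
real. -/
lemma multiBracket_mem_GR {A : Fin 2 → Matrix (Fin n) (Fin n) ℂ} (hA : ∀ l, (A l).IsHermitian)
    {Y : PolyField n 2} {k : Fin 2 → ℕ} (hY : Y ∈ G A (-1 + ((∑ l, k l : ℕ) : ℚ)))
    {a : ℕ} (ha : -1 + ((∑ l, k l : ℕ) : ℚ) + 1 / 2 = a / 2) :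
    multiBracket k Y ∈ GR A (-1) := by
  have ht := tangent_of_mem_aut hA (hY.1.natWeight ha) hY.2
  refine mem_GR_of_real hA ?_ fun l => ?_
  · have := multiBracket_hasWeight hY.1 k
    rwa [add_sub_cancel_right] at this
  · have := multiBracket_induction (P := fun Z => ∀ l, ∀ u : Fin 2 → ℝ,
      (ev 0 (fun l => (u l : ℂ)) (Z (MvPolynomial.X (Sum.inr l)))).im = 0)
      (fun Z l hZ m u => by
        rw [bracket_W_apply, map_neg, Complex.neg_im, real_pderiv (hZ m), neg_zero])
      (fun l u => ht.im_ev_zero l u) k l 0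
    rwa [show (fun l => (((0 : Fin 2 → ℝ) l : ℝ) : ℂ)) = 0 by ext; simp] at this

lemma IsRigid.ev_eq {X : PolyField n d} (hX : IsRigid X) (c : Fin n ⊕ Fin d) (z : Fin n → ℂ)
    (w w' : Fin d → ℂ) : ev z w (X (MvPolynomial.X c)) = ev z w' (X (MvPolynomial.X c)) := by
  refine MvPolynomial.eval₂Hom_congr' rfl ?_ rfl
  rintro (i | i) hi _
  · rfl
  · exact absurd hi (hX c i)

/-- A rigid infinitesimal automorphism without `∂/∂z`-part and of positive degree vanishes. -/
lemma eq_zero_of_rigid {A : Fin d → Matrix (Fin n) (Fin n) ℂ} {X : PolyField n d}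
    (hX : Tangent A X) (hr : IsRigid X) {a : ℕ} (hw : HasNatWeight a X)
    (h1 : ∀ j, X (MvPolynomial.X (Sum.inl j)) = 0) : X = 0 := by
  have him : ∀ l z, (ev z 0 (X (MvPolynomial.X (Sum.inr l)))).im = 0 := by
    intro l z
    have := hX (z, fun l => Complex.I * (hermForm (A l) z : ℂ)) (fun l => by simp [defFun]) l
    have h0 : (toMap X (z, fun l => Complex.I * (hermForm (A l) z : ℂ))).1 = 0 := by
      ext j
      simp [toMap, h1]
    rw [h0] at this
    rw [hr.ev_eq (Sum.inr l) z 0 (fun l => Complex.I * (hermForm (A l) z : ℂ))]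
    simpa [toMap] using this
  -- The coefficient is real at every `z`; scaling `z` by `t` with `t ^ (a + 1) = i` multiplies it
  -- by `i`, so it is also imaginary.
  obtain ⟨t, ht⟩ := IsAlgClosed.exists_pow_nat_eq Complex.I (Nat.succ_pos a)
  refine field_eq_zero h1 fun l => eq_zero_of_ev fun z w => ?_
  rw [hr.ev_eq (Sum.inr l) z w 0]
  have h2 := ev_smul (hw.2 l) t z 0
  rw [smul_zero, ht] at h2
  have h3 := him l (t • z)
  rw [h2, Complex.I_mul_im] at h3
  exact Complex.ext h3 (him l z)

lemma zPart_smul {Y : PolyField n d} {a m k : ℕ} (hw : HasNatWeight a Y) (h : a = 2 * m + k)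
    {c : ℂ} (hc : c ≠ 0) (z : Fin n → ℂ) (w : Fin d → ℂ) :
    zPart Y k z (c • w) = c ^ m • zPart Y k z w :=
  funext fun j => slice_coeff_smul' (hw.1 j) h hc z w

lemma wPart_smul {Y : PolyField n d} {a m k : ℕ} (hw : HasNatWeight a Y) (h : a + 1 = 2 * m + k)
    {c : ℂ} (hc : c ≠ 0) (z : Fin n → ℂ) (w : Fin d → ℂ) :
    wPart Y k z (c • w) = c ^ m • wPart Y k z w :=
  funext fun j => slice_coeff_smul' (hw.2 j) h hc z w

lemma add_I_smul_herm (A : Fin d → Matrix (Fin n) (Fin n) ℂ) (z : Fin n → ℂ) (s : ℝ) :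
    ((s : ℂ) + Complex.I) • herm A z
      = fun l => ((s * hermForm (A l) z : ℝ) : ℂ) + Complex.I * herm A z l := by
  ext l
  simp [herm, add_mul]

lemma add_I_ne_zero (s : ℝ) : (s : ℂ) + Complex.I ≠ 0 := fun h => by
  simpa using congrArg Complex.im h

/-- The `∂/∂w`-part of a field of weight `2` vanishes at `z = 0`. -/
lemma wPart_eq_zero {A : Fin 2 → Matrix (Fin n) (Fin n) ℂ} (hA : Nondegenerate A)
    {Y : PolyField n 2} (hY : Tangent A Y) (hw : HasNatWeight 5 Y) (l : Fin 2) (w : Fin 2 → ℂ) :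
    ev 0 w (Y (MvPolynomial.X (Sum.inr l))) = 0 := by
  refine eq_zero_of_herm_eq_zero hA (g := fun w => ev 0 w (Y (MvPolynomial.X (Sum.inr l))))
    (differentiable_ev _ 0) (fun z => ?_) w
  have him := hY.im_ev_zero l (fun l => hermForm (A l) z)
  have hpart : wPart Y 0 z (herm A z) l = ev 0 (herm A z) (Y (MvPolynomial.X (Sum.inr l))) :=
    slice_coeff_zero _ _ _
  change (ev 0 (herm A z) _).im = 0 at him
  have key : ∀ s : ℝ, (((s : ℂ) + Complex.I) ^ 3 * wPart Y 0 z (herm A z) l).im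
      = 2 * (((s : ℂ) + Complex.I) ^ 2 * (star z ⬝ᵥ (A l *ᵥ zPart Y 1 z (herm A z)))).re := by
    intro s
    have := (tangent_parts hY z _ (add_I_smul_herm A z s) l).1
    rwa [wPart_smul hw (m := 3) rfl (add_I_ne_zero s), zPart_smul hw (m := 2) rfl (add_I_ne_zero s),
      Matrix.mulVec_smul, dotProduct_smul, smul_eq_mul, Pi.smul_apply, smul_eq_mul] at this
  rw [hpart] at key
  generalize ev 0 (herm A z) _ = h at him key
  -- Both `(1 + i)³` and `(-1 + i)³` have imaginary part `2`, while `(±1 + i)² = ±2i`; adding the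
  -- two identities eliminates the `zPart` term.
  have h1 := key 1
  have h2 := key (-1)
  simp [pow_succ, him] at h1 h2
  refine Complex.ext ?_ him
  simp only [Complex.zero_re]
  linarith

/-- The `∂/∂z`-part of a field of weight `3/2` vanishes at `z = 0`. -/
lemma zPart_eq_zero {A : Fin 2 → Matrix (Fin n) (Fin n) ℂ} (hA : Nondegenerate A)
    {Y : PolyField n 2} (hY : Tangent A Y) (hw : HasNatWeight 4 Y) (j : Fin n) (w : Fin 2 → ℂ) :
    ev 0 w (Y (MvPolynomial.X (Sum.inl j))) = 0 := by
  refine congrFun (eq_zero_of_bil_herm_eq_zero hA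
    (F := fun w j => ev 0 w (Y (MvPolynomial.X (Sum.inl j))))
    (differentiable_pi.mpr fun j => differentiable_ev _ 0) (fun z l => ?_) w) j
  have hpart : zPart Y 0 z (herm A z)
      = fun j => ev 0 (herm A z) (Y (MvPolynomial.X (Sum.inl j))) :=
    funext fun j => slice_coeff_zero _ _ _
  rw [← hpart]
  have key : ∀ s : ℝ, ((s : ℂ) + Complex.I) ^ 2 * wPart Y 1 z (herm A z) l
      = 2 * Complex.I * (((s : ℂ) + Complex.I) * (star z ⬝ᵥ (A l *ᵥ zPart Y 2 z (herm A z)))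
        + ((s : ℂ) - Complex.I) ^ 2
          * starRingEnd ℂ (star z ⬝ᵥ (A l *ᵥ zPart Y 0 z (herm A z)))) := by
    intro s
    have := (tangent_parts hY z _ (add_I_smul_herm A z s) l).2
    rw [wPart_smul hw (m := 2) rfl (add_I_ne_zero s), zPart_smul hw (m := 1) rfl (add_I_ne_zero s),
      zPart_smul hw (m := 2) rfl (add_I_ne_zero s),
      Matrix.mulVec_smul, dotProduct_smul, smul_eq_mul, Matrix.mulVec_smul, dotProduct_smul,
      smul_eq_mul, Pi.smul_apply, smul_eq_mul, pow_one, map_mul, map_pow, map_add,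
      Complex.conj_ofReal, Complex.conj_I, ← sub_eq_add_neg] at this
    exact this
  generalize star z ⬝ᵥ (A l *ᵥ zPart Y 0 z (herm A z)) = g at key ⊢
  generalize star z ⬝ᵥ (A l *ᵥ zPart Y 2 z (herm A z)) = f at key
  generalize wPart Y 1 z (herm A z) l = h at key
  -- Adding the cases `s = 1` and `s = -1` kills `f`; then `s = 0` gives `h = 2i conj g`, whereas `s
  -- = 1` gives `h = -2i conj g`.
  have h0 := key 0
  have h1 := key 1
  have h2 := key (-1)
  push_cast at h0 h1 h2
  have hI := Complex.I_sq
  have hf : f = 0 := by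
    have : (2 * Complex.I) * (2 * Complex.I) * f = 0 := by
      linear_combination -h1 - h2 + (2 * h - 4 * Complex.I * starRingEnd ℂ g) * hI
    simpa using this
  subst hf
  have hg : starRingEnd ℂ g = 0 := by
    have h3 : h = 2 * Complex.I * starRingEnd ℂ g := by
      linear_combination -h0 + (h - 2 * Complex.I * starRingEnd ℂ g) * hI
    rw [h3] at h1
    have : (8 : ℂ) * starRingEnd ℂ g = 0 := by
      linear_combination -h1 + 8 * starRingEnd ℂ g * hI
    simpa using this
  simpa using hg

end

/-! ### Weight `1`, the Euler field, and the zero field -/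

section

variable {n : ℕ}

lemma pderiv_pderiv_eq_zero {Y : PolyField n 2}
    (h : ∀ k : Fin 2 → ℕ, ∑ l, k l = 2 → multiBracket k Y = 0) (c : Fin n ⊕ Fin 2) (i j : Fin 2) :
    MvPolynomial.pderiv (Sum.inr i) (MvPolynomial.pderiv (Sum.inr j) (Y (MvPolynomial.X c)))
      = 0 := by
  have h1 := DFunLike.congr_fun (h ![2, 0] (by simp)) (MvPolynomial.X c)
  have h2 := DFunLike.congr_fun (h ![1, 1] (by simp)) (MvPolynomial.X c)
  have h3 := DFunLike.congr_fun (h ![0, 2] (by simp)) (MvPolynomial.X c)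
  simp only [multiBracket_two, bracketW, Matrix.cons_val_zero, Matrix.cons_val_one,
    Function.iterate_succ, Function.iterate_zero, Function.comp_apply, id_eq, bracket_W_apply,
    map_neg, neg_neg, Derivation.zero_apply] at h1 h2 h3
  fin_cases i <;> fin_cases j
  · exact h1
  · exact h2
  · rw [pderiv_comm]; exact h2
  · exact h3

lemma ev_zero_of_pderiv_pderiv {d : ℕ} {f : Poly n d}
    (hf : MvPolynomial.IsWeightedHomogeneous (natWt n d) f 4)
    (h : ∀ i j, MvPolynomial.pderiv (Sum.inr i) (MvPolynomial.pderiv (Sum.inr j) f) = 0)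
    (w : Fin d → ℂ) : ev 0 w f = 0 := by
  have h1 : ∀ j, ev 0 w (MvPolynomial.pderiv (Sum.inr j) f) = 0 := by
    intro j
    simpa [h] using euler_zero (pderiv_inr_weight (N := 2) hf j) w
  simpa only [h1, mul_zero, Finset.sum_const_zero, Nat.cast_ofNat, zero_eq_mul,
    OfNat.ofNat_ne_zero, false_or] using euler_zero hf w

/-- The matrices of the part of bidegree `(1, 1)` in `(z, w)` of the `∂/∂z`-coefficients. -/
noncomputable def linearPart {d : ℕ} (Y : PolyField n d) (l : Fin d) : Matrix (Fin n) (Fin n) ℂ :=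
  Matrix.of fun j i => ev 0 0 (MvPolynomial.pderiv (Sum.inr l)
    (MvPolynomial.pderiv (Sum.inl i) (Y (MvPolynomial.X (Sum.inl j)))))

lemma zPart_one_eq {d : ℕ} {Y : PolyField n d} (hw : HasNatWeight 3 Y) (z : Fin n → ℂ)
    (w : Fin d → ℂ) : zPart Y 1 z w = ∑ l, w l • (linearPart Y l *ᵥ z) := by
  ext j
  have h : ∀ i, ev 0 w (MvPolynomial.pderiv (Sum.inl i) (Y (MvPolynomial.X (Sum.inl j))))
      = ∑ l, w l * linearPart Y l j i := by
    intro i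
    have hi := pderiv_inl_weight (N := 2) (hw.1 j) i
    have := euler_zero hi w
    rw [← Finset.mul_sum] at this
    push_cast at this
    rw [← mul_left_cancel₀ two_ne_zero this]
    refine Finset.sum_congr rfl fun l _ => ?_
    rw [ev_eq_of_weight_zero (pderiv_inr_weight (N := 0) hi l)]
    rfl
  simp only [zPart, slice_coeff_one, h, Finset.sum_apply, Pi.smul_apply, smul_eq_mul,
    Matrix.mulVec, dotProduct, Finset.mul_sum]
  rw [Finset.sum_comm]
  exact Finset.sum_congr rfl fun _ _ => Finset.sum_congr rfl fun _ _ => by ring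

/-- Vanishing double brackets remove the `∂/∂w`-part at `z = 0`, so mode `0` of tangency constrains
only the matrices `linearPart Y k`. Its dependence on the free real vector `u` and its value at `u =
0` give the two hypotheses of `matrices_eq_zero`. -/
lemma linearPart_eq_zero {A : Fin 2 → Matrix (Fin n) (Fin n) ℂ} (hA : Nondegenerate A)
    {Y : PolyField n 2} (hY : Tangent A Y) (hw : HasNatWeight 3 Y)
    (h : ∀ k : Fin 2 → ℕ, ∑ l, k l = 2 → multiBracket k Y = 0) (k : Fin 2) :
    linearPart Y k = 0 := by
  have key : ∀ (z : Fin n → ℂ) (u : Fin 2 → ℝ) (l : Fin 2),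
      (∑ k, ((u k : ℂ) + Complex.I * herm A z k)
        * bil (A l * linearPart Y k) (star z) z).re = 0 := by
    intro z u l
    have := (tangent_parts hY z u rfl l).1
    have h0 : wPart Y 0 z (fun l => (u l : ℂ) + Complex.I * herm A z l) l = 0 := by
      rw [wPart, slice_coeff_zero]
      exact ev_zero_of_pderiv_pderiv (hw.2 l) (pderiv_pderiv_eq_zero h _) _
    rw [h0, zPart_one_eq hw, Matrix.mulVec_sum, dotProduct_sum] at this
    simp only [Matrix.mulVec_smul, dotProduct_smul, smul_eq_mul] at this
    have h1 := (mul_eq_zero.mp this.symm).resolve_left two_ne_zero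
    simpa only [bil, Matrix.mulVec_mulVec] using h1
  have hre : ∀ k l z, (bil (A l * linearPart Y k) (star z) z).re = 0 := by
    intro k l z
    have h0 := key z 0 l
    have h1 := key z (Pi.single k 1) l
    simp only [add_mul, Finset.sum_add_distrib, Complex.add_re, Pi.zero_apply,
      Complex.ofReal_zero, zero_add] at h0 h1
    rw [h0, add_zero, Finset.sum_eq_single k (by intro b _ hb; simp [hb])
      (by simp)] at h1
    simpa using h1
  refine matrices_eq_zero hA (linearPart Y) hre (fun l z => ?_) k
  have h0 := key z 0 l
  simp only [Pi.zero_apply, Complex.ofReal_zero, zero_add, mul_assoc, ← Finset.mul_sum,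
    Complex.I_mul_re, neg_eq_zero] at h0
  refine Complex.ext ?_ h0
  rw [Complex.re_sum]
  refine Finset.sum_eq_zero fun k _ => ?_
  rw [herm, Complex.re_ofReal_mul, hre, mul_zero]

/-- A rigid polynomial of weight `1/2` is determined by its first derivatives in `z`. -/
lemma eq_zero_of_pderiv_inl {d : ℕ} {f : Poly n d}
    (hf : MvPolynomial.IsWeightedHomogeneous (natWt n d) f 1)
    (hr : ∀ z w w', ev z w f = ev z w' f)
    (h : ∀ j, ev 0 0 (MvPolynomial.pderiv (Sum.inl j) f) = 0) : f = 0 := by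
  refine eq_zero_of_ev fun z w => ?_
  have hs : slice f z w = Polynomial.C (ev z w f) * Polynomial.X := by
    refine Polynomial.funext fun t => ?_
    rw [eval_slice, hr (t • z) w (t ^ 2 • w), ev_smul hf, pow_one,
      Polynomial.eval_mul, Polynomial.eval_C, Polynomial.eval_X, mul_comm]
  have h1 := slice_coeff_one f z w
  rw [hs, Polynomial.coeff_C_mul, Polynomial.coeff_X_one, mul_one] at h1
  rw [h1]
  refine Finset.sum_eq_zero fun j _ => ?_
  rw [ev_eq_of_weight_zero (pderiv_inl_weight (N := 0) hf j), h, mul_zero]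

/-- If all double brackets vanished, so would `linearPart Y`. But the `∂/∂z`-coefficients of the
rigid field `X = ⁅Y, W l⁆` are linear in `z` with matrix `-linearPart Y l`, so `eq_zero_of_rigid`
would give `X = 0`. -/
lemma exists_multiBracket_ne_zero {A : Fin 2 → Matrix (Fin n) (Fin n) ℂ} (hA : Nondegenerate A)
    {X Y : PolyField n 2} {k : Fin 2 → ℕ} (hk : ∑ l, k l = 1) (hX : X ∈ GR A 0) (hY : Y ∈ G A 1)
    (hXY : multiBracket k Y = X) (hX0 : X ≠ 0) :
    ∃ k' : Fin 2 → ℕ, ∑ l, k' l = 2 ∧ multiBracket k' Y ≠ 0 := by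
  by_contra! h
  have hwY : HasNatWeight 3 Y := hY.1.natWeight (by norm_num)
  have hwX : HasNatWeight 1 X := hX.1.1.natWeight (by norm_num)
  have htY := tangent_of_mem_aut hA.isHermitian hwY hY.2
  have htX := tangent_of_mem_aut hA.isHermitian hwX hX.1.2
  have hB := linearPart_eq_zero hA htY hwY h
  obtain ⟨l, hl⟩ : ∃ l : Fin 2, X = ⁅Y, W l⁆ := by
    rw [Fin.sum_univ_two] at hk
    rcases (by omega : k 0 = 1 ∧ k 1 = 0 ∨ k 0 = 0 ∧ k 1 = 1) with ⟨h0, h1⟩ | ⟨h0, h1⟩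
    · exact ⟨0, by rw [← hXY, multiBracket_two, h0, h1]; rfl⟩
    · exact ⟨1, by rw [← hXY, multiBracket_two, h0, h1]; rfl⟩
  refine hX0 (eq_zero_of_rigid htX hX.2 hwX fun j => ?_)
  refine eq_zero_of_pderiv_inl (hwX.1 j) (hX.2.ev_eq _) fun i => ?_
  rw [hl, bracket_W_apply, map_neg, map_neg, pderiv_comm, neg_eq_zero]
  exact congrFun (congrFun (hB l) j) i

/-- The Euler field `½ ∑ z_j ∂/∂z_j + ∑ w_l ∂/∂w_l`. -/
noncomputable def eulerField (n d : ℕ) : PolyField n d :=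
  MvPolynomial.mkDerivation ℂ (Sum.elim
    (fun j => MvPolynomial.C (1 / 2) * MvPolynomial.X (Sum.inl j))
    (fun l => MvPolynomial.X (Sum.inr l)))

lemma eulerField_mem {d : ℕ} {A : Fin d → Matrix (Fin n) (Fin n) ℂ}
    (hA : ∀ l, (A l).IsHermitian) : eulerField n d ∈ G A 0 := by
  have hmap : toMap (eulerField n d) = fun p => ((1 / 2 : ℂ) • p.1, p.2) := by
    funext p
    refine Prod.ext (funext fun j => ?_) (funext fun l => ?_) <;> simp [toMap, eulerField]
  refine ⟨⟨fun j => ?_, fun l => ?_⟩, ?_, ?_⟩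
  · simp only [eulerField, MvPolynomial.mkDerivation_X, Sum.elim_inl]
    have := (MvPolynomial.isWeightedHomogeneous_C (wt n d) (1 / 2 : ℂ)).mul
      (MvPolynomial.isWeightedHomogeneous_X ℂ (wt n d) (Sum.inl j))
    exact this
  · simp only [eulerField, MvPolynomial.mkDerivation_X, Sum.elim_inr, zero_add]
    exact MvPolynomial.isWeightedHomogeneous_X ℂ (wt n d) (Sum.inr l)
  · rw [hmap]
    have h1 : AnalyticAt ℂ (fun p : Ambient n d => p.1) 0 := analyticAt_fst
    have h2 : AnalyticAt ℂ (fun p : Ambient n d => p.2) 0 := analyticAt_snd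
    exact (h1.const_smul (c := (1 / 2 : ℂ))).prod h2
  · filter_upwards [self_mem_nhdsWithin] with p hp l
    rw [fderiv_defFun (hA l), hmap]
    have := hp l
    rw [defFun, hermForm] at this
    have h2 : (1 / 2 : ℂ) = ((1 / 2 : ℝ) : ℂ) := by norm_num
    simp only [Matrix.mulVec_smul, dotProduct_smul, smul_eq_mul]
    rw [h2, Complex.re_ofReal_mul]
    linarith

lemma zero_mem_integrations (A : Fin 2 → Matrix (Fin n) (Fin n) ℂ) (m : ℕ) (μ : ℚ) :
    (0 : PolyField n 2) ∈ integrations A m μ := by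
  have h0 : ∀ ν : ℚ, (0 : PolyField n 2) ∈ G A ν := by
    intro ν
    have hmap : toMap (0 : PolyField n 2) = fun _ => 0 := by
      funext p
      refine Prod.ext (funext fun j => ?_) (funext fun l => ?_) <;> simp [toMap]
    refine ⟨⟨fun j => ?_, fun l => ?_⟩, ?_, ?_⟩
    · exact MvPolynomial.isWeightedHomogeneous_zero _ _ _
    · exact MvPolynomial.isWeightedHomogeneous_zero _ _ _
    · rw [hmap]; exact analyticAt_const
    · rw [hmap]; simp
  exact ⟨![m, 0], 0, by simp, ⟨h0 _, by simp [IsRigid]⟩, h0 _,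
    multiBracket_induction (P := fun Z : PolyField n 2 => Z = 0)
      (by rintro Z l rfl; exact zero_lie (W l)) rfl _, fun _ => rfl⟩

end

end QuadricAut

/-! ### Assembly of the three assertions -/

theorem mainTheorem5 (n : ℕ) (A : Fin 2 → Matrix (Fin n) (Fin n) ℂ)
    (hA : QuadricAut.Nondegenerate A) :
    (QuadricAut.integrations A 1 0 \
        (QuadricAut.integrations A 1 0 ∩ QuadricAut.integrations A 2 (-1)) ⊆ {0}) ∧
    QuadricAut.integrations A 2 (-1 / 2) = {0} ∧
    ((∃ Y ∈ QuadricAut.integrations A 1 (-1), Y ≠ 0) ∧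
      QuadricAut.integrations A 3 (-1) = {0}) := by
  open QuadricAut in
  refine ⟨?_, ?_, ⟨eulerField n 2, ?_, ?_⟩, ?_⟩
  · rintro Y ⟨hY1, hY2⟩
    by_contra hY0
    apply hY2
    refine ⟨hY1, ?_⟩
    obtain ⟨k, X, hk, hX, hY, hXY, h0⟩ := hY1
    rw [hk] at hY
    have hY' : Y ∈ G A 1 := by simpa using hY
    obtain ⟨k', hk', hne⟩ := exists_multiBracket_ne_zero hA hk hX hY' hXY fun h => hY0 (h0 h)
    have hY'' : Y ∈ G A (-1 + ((∑ l, k' l : ℕ) : ℚ)) := by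
      rw [hk']
      convert hY' using 1
      norm_num
    exact ⟨k', multiBracket k' Y, hk',
      multiBracket_mem_GR (a := 3) hA.isHermitian hY'' (by rw [hk']; norm_num),
      hY'', rfl, fun h => absurd h hne⟩
  · refine Set.eq_singleton_iff_unique_mem.mpr ⟨zero_mem_integrations A 2 _, ?_⟩
    rintro Y ⟨k, X, hk, hX, hY, hXY, h0⟩
    rw [hk] at hY
    have hwY : HasNatWeight 4 Y := hY.1.natWeight (by norm_num)
    have hwX : HasNatWeight 0 X := hX.1.1.natWeight (by norm_num)
    have htY := tangent_of_mem_aut hA.isHermitian hwY hY.2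
    -- Vanishing along `z = 0` survives differentiation in `w`, so it passes from `Y` to `X`, whose
    -- `∂/∂z`-coefficients are constants.
    have hX0 := multiBracket_induction
      (P := fun Z => ∀ j w, ev 0 w (Z (MvPolynomial.X (Sum.inl j))) = 0)
      (fun Z l hZ j w => by rw [bracket_W_apply, map_neg, ev_zero_pderiv (hZ j), neg_zero])
      (zPart_eq_zero hA htY hwY) k
    rw [hXY] at hX0
    refine h0 (eq_zero_of_rigid (tangent_of_mem_aut hA.isHermitian hwX hX.1.2) hX.2 hwX
      fun j => ?_)
    rw [eq_C_of_weight_zero (hwX.1 j), hX0, map_zero]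
  -- The bracket of the Euler field with `W 0` is `-W 0`, which is nonzero.
  · have hE : eulerField n 2 ∈ G A (-1 + ((∑ l, (![1, 0] : Fin 2 → ℕ) l : ℕ) : ℚ)) := by
      simpa using eulerField_mem hA.isHermitian
    refine ⟨![1, 0], multiBracket ![1, 0] (eulerField n 2), by simp,
      multiBracket_mem_GR (a := 1) hA.isHermitian hE (by simp), hE, rfl, fun h => ?_⟩
    have h1 := DFunLike.congr_fun h (MvPolynomial.X (Sum.inr 0))
    simp [multiBracket_two, bracketW, bracket_W_apply, eulerField] at h1
  · intro h
    have h1 := DFunLike.congr_fun h (MvPolynomial.X (Sum.inr 0))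
    simp [eulerField] at h1
  · refine Set.eq_singleton_iff_unique_mem.mpr ⟨zero_mem_integrations A 3 _, ?_⟩
    rintro Y ⟨k, X, hk, hX, hY, hXY, h0⟩
    rw [hk] at hY
    have hwY : HasNatWeight 5 Y := hY.1.natWeight (by norm_num)
    have htY := tangent_of_mem_aut hA.isHermitian hwY hY.2
    have hX0 := multiBracket_induction
      (P := fun Z => ∀ j w, ev 0 w (Z (MvPolynomial.X (Sum.inr j))) = 0)
      (fun Z l hZ j w => by rw [bracket_W_apply, map_neg, ev_zero_pderiv (hZ j), neg_zero])
      (wPart_eq_zero hA htY hwY) k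
    rw [hXY] at hX0
    refine h0 (field_eq_zero (fun j => eq_zero_of_weight_neg (hX.1.1.1 j) (by norm_num))
      fun l => ?_)
    rw [eq_C_of_weight_zero (isWeightedHomogeneous_natWt (hX.1.1.2 l) (by norm_num)), hX0,
      map_zero]
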